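/- Let $n\ge 0$, $\ell\ge 2$. Let $\Lambda_i(y)=L_i(y)+\lambda_i$, $i=0,\dots,n+\ell$, be real affine forms on $\mathbb R^\ell$, and let ${\mathcal B}=(\beta_i^{(k)})$ be a real $(n+\ell+1)\times\ell$ matrix, with rows indexed by the forms, all of whose columns sum to $0$. Assume that the open polyhedron $\Delta=\{y\in\mathbb R^\ell : \Lambda_i(y)>0 \text{ for all } i\}$ is nonempty and bounded. Faces and vertices of $\Delta$ are the nonempty faces and the vertices of its closure. For a face $P$ let ${\mathcal B}_{P,j}$ be the submatrix of ${\mathcal B}$ consisting of the first $j$ columns of the rows whose forms vanish identically on $P$; it annihilates a nonzero nonnegative row vector if $v{\mathcal B}_{P,j}=0$ for some row vector $v\ne 0$ with all $v_i\ge 0$. Assume 1. exactly $\ell$ of the forms $\Lambda_i$ vanish at each vertex of $\Delta$; 2. for every face $P$ of $\Delta$, the matrix ${\mathcal B}_{P,\operatorname{codim} P}$ annihilates no nonzero nonnegative row vector. On $\Delta$ put $\phi_k(y)=\sum_i\beta_i^{(k)}\log\Lambda_i(y)$ for $k=1,\dots,\ell$, and for $k=\ell,\ell-1,\dots,1$ let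 $J_k$ be the Jacobian determinant of $\phi_1,\dots,\phi_k,J_{k+1},\dots,J_\ell$. For $2\le j\le\ell$ let $\mu_j$ be the closure of $\{y\in\Delta:\phi_1(y)=\dots=\phi_{j-1}(y)=0\}$, let $\gamma_j=\{y\in\Delta : \phi_1(y)=\dots=\phi_{j-1}(y)=J_{j+1}(y)=\dots=J_\ell(y)=0\}$, and let $T_j=\overline{\gamma_j}\cap\partial\Delta$. Let ${\mathcal F}_j$ be the set of faces $P$ of $\Delta$ of codimension $j$ for which ${\mathcal B}_{P,j-1}$ annihilates a nonzero nonnegative row vector, and let $M_{\ell-j}(\Delta,{\mathcal B})=|{\mathcal F}_j|$. Then, for every $j$ with $2\le j\le \ell$: (a) $\mu_j\cap\partial\Delta=\bigcup_{P\in{\mathcal F}_j}P$. (b) For each $k$ there is a polynomial $\widetilde J_k$ that equals $J_k\cdot\bigl(\prod_i\Lambda_i\bigr)^{2^{\ell-k}}$ on $\Delta$ (it is unique). Let $Z_j$ be the set of points of $\mu_j\cap\partial\Delta$ where $\widetilde J_{j+1},\dots,\widetilde J_\ell$ all vanish. Then $T_j\subseteq Z_j$; in particular $T_j\subseteq\bigcup_{P\in{\mathcal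 F}_j}P$. (c) Suppose that for every $P\in{\mathcal F}_j$ the polynomials $\widetilde J_{j+1},\dots,\widetilde J_\ell$ have only finitely many common zeros on the complex affine span of $P$. Then $Z_j$ and $T_j$ are finite and $$|T_j|\le|Z_j|\le M_{\ell-j}(\Delta,{\mathcal B})\cdot 2^{\binom{\ell-j}{2}}\,n^{\ell-j}.$$ -/

import Mathlib

open scoped Matrix

/-- The data of a Gale dual system of master functions in `ℓ` variables: the `n + ℓ + 1` affine
forms `Λ_i(y) = L_i(y) + λ_i` and the matrix `B` of exponents (rows indexed by the forms, columns
by the `ℓ` equations).  The columns of `B` sum to zero: in the bounded form of the system one form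
`Λ_0` is added, with exponent `β_0 = - ∑ β_i` in each equation (`Λ_0 = 1` if the polyhedron of the
original `n + ℓ` forms is already bounded). -/
structure GaleSystem (n ℓ : ℕ) where
  /-- The coefficients of the linear forms `L_i`. -/
  L : Matrix (Fin (n + ℓ + 1)) (Fin ℓ) ℝ
  /-- The constant terms `λ_i`. -/
  lam : Fin (n + ℓ + 1) → ℝ
  /-- The exponent matrix; column `k` is the exponent vector `β^(k+1)`. -/
  B : Matrix (Fin (n + ℓ + 1)) (Fin ℓ) ℝ
  colSum : ∀ k, ∑ i, B i k = 0

namespace GaleSystem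

variable {n ℓ : ℕ}

/-- The affine form `Λ_i(y) = L_i(y) + λ_i`. -/
def form (G : GaleSystem n ℓ) (i : Fin (n + ℓ + 1)) (y : Fin ℓ → ℝ) : ℝ :=
  (G.L *ᵥ y) i + G.lam i

/-- The positive chamber `Δ` (an open polyhedron). -/
def chamber (G : GaleSystem n ℓ) : Set (Fin ℓ → ℝ) :=
  {y | ∀ i, 0 < G.form i y}

/-! ### Faces and the exponent submatrices -/

/-- Nonempty faces of the polyhedron `Δ`, that is, of its closure (the polyhedron is a face of
itself). -/
def IsFace (G : GaleSystem n ℓ) (P : Set (Fin ℓ → ℝ)) : Prop :=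
  P.Nonempty ∧ IsExposed ℝ (closure G.chamber) P

/-- The codimension in `ℝ^ℓ` of (the affine span of) `P`. -/
noncomputable def codim (_G : GaleSystem n ℓ) (P : Set (Fin ℓ → ℝ)) : ℕ :=
  ℓ - Module.finrank ℝ (affineSpan ℝ P).direction

/-- The matrix `B_{P,j}`: the rows of `B` whose affine forms vanish on `P`, and the first `j`
columns. -/
def subB (G : GaleSystem n ℓ) (P : Set (Fin ℓ → ℝ)) (j : ℕ) :
    Matrix {i : Fin (n + ℓ + 1) // ∀ p ∈ P, G.form i p = 0} {k : Fin ℓ // (k : ℕ) < j} ℝ :=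
  G.B.submatrix Subtype.val Subtype.val

open Classical in
/-- `B_{P,j}` annihilates a nonzero nonnegative row vector. -/
def AnnihilatesNonneg (G : GaleSystem n ℓ) (P : Set (Fin ℓ → ℝ)) (j : ℕ) : Prop :=
  ∃ v : {i : Fin (n + ℓ + 1) // ∀ p ∈ P, G.form i p = 0} → ℝ,
    v ≠ 0 ∧ 0 ≤ v ∧ v ᵥ* G.subB P j = 0

/-- The faces `P` of codimension `j` for which `B_{P,j-1}` annihilates a nonzero nonnegative row
vector. -/
def specialFaces (G : GaleSystem n ℓ) (j : ℕ) : Set (Set (Fin ℓ → ℝ)) :=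
  {P | G.IsFace P ∧ G.codim P = j ∧ G.AnnihilatesNonneg P (j - 1)}

/-- General position: exactly `ℓ` of the affine forms vanish at each vertex of `Δ`. -/
def GeneralPosition (G : GaleSystem n ℓ) : Prop :=
  ∀ p ∈ (closure G.chamber).extremePoints ℝ, {i | G.form i p = 0}.ncard = ℓ

/-- For every face `P`, the matrix `B_{P,codim P}` annihilates no nonzero nonnegative row vector. -/
def NoNonnegKernel (G : GaleSystem n ℓ) : Prop :=
  ∀ P, G.IsFace P → ¬ G.AnnihilatesNonneg P (G.codim P)

/-! ### The logarithmic system, the iterated Jacobians, and the sets they define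

The functions `φ_1, …, φ_ℓ` and `J_1, …, J_ℓ` are indexed by `Fin ℓ`; the index `k : Fin ℓ` stands
for the usual index `k + 1`. -/

/-- `phi k` is `φ_{k+1}(y) = ∑_i β_i^{(k+1)} log Λ_i(y)` (meaningful on `Δ`). -/
noncomputable def phi (G : GaleSystem n ℓ) (k : Fin ℓ) (y : Fin ℓ → ℝ) : ℝ :=
  ∑ i, G.B i k * Real.log (G.form i y)

/-- The Jacobian determinant `det (∂f_r / ∂y_c)`. -/
noncomputable def jacobian (f : Fin ℓ → (Fin ℓ → ℝ) → ℝ) (y : Fin ℓ → ℝ) : ℝ :=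
  Matrix.det (Matrix.of fun r c : Fin ℓ => fderiv ℝ (f r) y (Pi.single c 1))

/-- `J k` is `J_{k+1}`, the Jacobian of `φ_1, …, φ_{k+1}, J_{k+2}, …, J_ℓ` (meaningful on the open
set `Δ`). -/
noncomputable def J (G : GaleSystem n ℓ) (k : Fin ℓ) : (Fin ℓ → ℝ) → ℝ :=
  jacobian fun r => if _h : k < r then G.J r else G.phi r
termination_by ℓ - (k : ℕ)

/-- `μ_j`: the closure of the common zeros in `Δ` of `φ_1, …, φ_{j-1}`. -/
def mu (G : GaleSystem n ℓ) (j : ℕ) : Set (Fin ℓ → ℝ) :=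
  closure {y ∈ G.chamber | ∀ k : Fin ℓ, (k : ℕ) + 1 < j → G.phi k y = 0}

/-- `γ_j`: the common zeros in `Δ` of `φ_1, …, φ_{j-1}, J_{j+1}, …, J_ℓ`. -/
def gam (G : GaleSystem n ℓ) (j : ℕ) : Set (Fin ℓ → ℝ) :=
  {y ∈ G.chamber | (∀ k : Fin ℓ, (k : ℕ) + 1 < j → G.phi k y = 0) ∧
    ∀ k : Fin ℓ, j < (k : ℕ) + 1 → G.J k y = 0}

/-- `T_j`: the points where `γ_j` meets the boundary of `Δ`. -/
def T (G : GaleSystem n ℓ) (j : ℕ) : Set (Fin ℓ → ℝ) :=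
  closure (G.gam j) ∩ frontier G.chamber

/-- The polynomial `p` agrees on `Δ` with `J_i · (∏ Λ)^(2^(ℓ - i))`, where `i = k + 1`. -/
def IsClearedJacobian (G : GaleSystem n ℓ) (k : Fin ℓ) (p : MvPolynomial (Fin ℓ) ℝ) : Prop :=
  ∀ y ∈ G.chamber,
    MvPolynomial.eval y p = G.J k y * (∏ i, G.form i y) ^ (2 ^ (ℓ - ((k : ℕ) + 1)))

/-- The polynomial `J̃_{k+1}`.  It is unique as soon as `Δ` is nonempty. -/
noncomputable def Jtilde (G : GaleSystem n ℓ) (k : Fin ℓ) : MvPolynomial (Fin ℓ) ℝ :=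
  Classical.epsilon (G.IsClearedJacobian k)

/-- The points of `μ_j ∩ ∂Δ` where the polynomials `J̃_{j+1}, …, J̃_ℓ` vanish. -/
def boundaryZeros (G : GaleSystem n ℓ) (j : ℕ) : Set (Fin ℓ → ℝ) :=
  {y ∈ G.mu j ∩ frontier G.chamber |
    ∀ k : Fin ℓ, j < (k : ℕ) + 1 → MvPolynomial.eval y (G.Jtilde k) = 0}

/-- The common zeros of `J̃_{j+1}, …, J̃_ℓ` on the complex affine span of `P`. -/
def complexZeros (G : GaleSystem n ℓ) (P : Set (Fin ℓ → ℝ)) (j : ℕ) : Set (Fin ℓ → ℂ) :=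
  {z | z ∈ affineSpan ℂ ((fun (y : Fin ℓ → ℝ) (c : Fin ℓ) => (y c : ℂ)) '' P) ∧
    ∀ k : Fin ℓ, j < (k : ℕ) + 1 → MvPolynomial.aeval z (G.Jtilde k) = 0}

/-- `M_{ℓ-j}(Δ, B)`: the number of faces of codimension `j` for which `B_{P,j-1}` annihilates a
nonzero nonnegative row vector. -/
noncomputable def M (G : GaleSystem n ℓ) (j : ℕ) : ℕ :=
  (G.specialFaces j).ncard

end GaleSystem

/-!
The theorem has three ingredients.

*Geometry of the boundary.*  Because exactly `ℓ` forms vanish at each vertex, the forms vanishing at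
any point of the closed polyhedron have linearly independent linear parts (`exists_linForm_eq`).
Hence the faces through a point correspond to the subsets of the forms vanishing there, and the
codimension of a face is the number of forms vanishing on it (`rows_faceOf`, `codim_face`).  If a
linear combination of the first `j - 1` columns is positive in the rows of all the forms vanishing
at a boundary point `p`, the same combination of the `φ_k` tends to `-∞` at `p`, so `p` is not in
`μ_j`.  Otherwise the theorems of Gordan and Carathéodory give at most `j` of these rows with a
nonnegative relation; `NoNonnegKernel` forces at least `j` forms to vanish at `p`, so these rows can be
completed to exactly `j`, which define a special face through `p`
(`exists_specialFace_of_mem_mu`).  Conversely, on a special face the relation `v` is positive and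
unique up to scaling; putting `Λ_i = exp (s_i - τ v_i)` for the forms vanishing on the face turns
the equations `φ_k = 0` into a linear system in `s`, perturbed by a term which is small for large
`τ`, and a quantitative inverse function theorem solves it (`mem_mu_of_active`).

*The numerators of the iterated Jacobians.*  A Schur complement writes `J_k (∏ Λ_i) ^ (2 ^ (ℓ - k))`
as the determinant of a block matrix of polynomials built from the previous numerators
(`eval_clearedJac_fullExponent`).  Its degree may exceed `n * 2 ^ (ℓ - k)` by one.  The denominators
can be replaced by powers of a single form: this changes each numerator only by multiples of the
later ones (`exists_clearedJac_eq_add`), so the common zeros are the same, and with denominators of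
the same degree as the numerators Euler's identity gives the degree bound `n * 2 ^ (ℓ - k)`
(`hasDegLE_clearedJac`).

*Counting.*  On the complex affine span of a special face, parametrized by `ℂ ^ (ℓ - j)`, there are
as many equations as variables, and the affine Bézout inequality `ncard_zeros_le_prod_degree`
applies.  It is proved by deforming the polynomials `f_i` to `f_i + t x_i ^ d_i`: over `k(t)` the
deformed ideal has colength at most `∏ d_i`, so more than `∏ d_i` zeros would produce a polynomial
`h`, nonzero at a zero `p` of the `f_i` at `t = 0`, with `t ^ r h` in the deformed ideal.  Then
`(p, 0)` would be an isolated zero of the deformed system, that is, its maximal ideal, of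
height one more than the number of variables, would be minimal over an ideal with as many generators
as variables, against Krull's height theorem.
-/

/-! ### The affine Bézout inequality -/

section Bezout

open MvPolynomial

variable {k σ : Type*} [Field k]

/-- The maximal ideal of the point `(a, 0)` of affine space over `k[t]` has height at least one more
than the number of variables: fix the coordinates one after the other, and `t` last. -/
theorem card_succ_le_height_ker_eval [Fintype σ] (a : σ → k) :
    ((Fintype.card σ + 1 : ℕ) : ℕ∞) ≤
      (RingHom.ker ((Polynomial.evalRingHom 0).comp
        (eval (fun i => (Polynomial.C (a i) : Polynomial k))))).height := by
  classical
  let φ : Finset σ →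
      (MvPolynomial σ (Polynomial k) →ₐ[Polynomial k] MvPolynomial σ (Polynomial k)) :=
    fun s => aeval fun i => if i ∈ s then C (Polynomial.C (a i)) else X i
  have key : ∀ s : Finset σ, ((s.card : ℕ) : ℕ∞) ≤ (RingHom.ker (φ s)).height := by
    intro s
    induction s using Finset.induction_on with
    | empty => simp
    | insert i s hi ih =>
      have hp1 : (RingHom.ker (φ s)).IsPrime := RingHom.ker_isPrime _
      have hp2 : (RingHom.ker (φ (insert i s))).IsPrime := RingHom.ker_isPrime _
      have hcomp : (φ (insert i s)).comp (φ s) = φ (insert i s) := by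
        apply MvPolynomial.algHom_ext
        intro m
        by_cases hm : m ∈ s
        · simp [φ, hm, MvPolynomial.algebraMap_eq]
        · simp [φ, hm]
      have hlt : RingHom.ker (φ s) < RingHom.ker (φ (insert i s)) := by
        refine lt_of_le_of_ne (fun p hp => ?_) (fun h => ?_)
        · rw [RingHom.mem_ker] at hp ⊢
          rw [← hcomp, AlgHom.comp_apply, hp, map_zero]
        · have hx : (X i - C (Polynomial.C (a i)) : MvPolynomial σ (Polynomial k)) ∈
              RingHom.ker (φ (insert i s)) := by
            simp [RingHom.mem_ker, φ, MvPolynomial.algebraMap_eq]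
          rw [← h, RingHom.mem_ker] at hx
          have : (X i : MvPolynomial σ (Polynomial k)) = C (Polynomial.C (a i)) := by
            simpa [φ, hi, MvPolynomial.algebraMap_eq, sub_eq_zero] using hx
          have h1 := congrArg (fun p => p.totalDegree) this
          simp at h1
      rw [Finset.card_insert_of_notMem hi]
      push_cast
      exact (add_le_add_left ih 1).trans (Ideal.height_add_one_le_of_lt_of_isPrime hlt)
  have hp1 : (RingHom.ker (φ Finset.univ)).IsPrime := RingHom.ker_isPrime _
  have hp2 : (RingHom.ker ((Polynomial.evalRingHom 0).comp
      (eval (fun i => (Polynomial.C (a i) : Polynomial k))))).IsPrime := RingHom.ker_isPrime _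
  have hφ : ∀ p, φ Finset.univ p = C (eval (fun i => (Polynomial.C (a i) : Polynomial k)) p) := by
    intro p
    induction p using MvPolynomial.induction_on with
    | C r => simp [φ, MvPolynomial.algebraMap_eq]
    | add p q hp hq => simp [hp, hq]
    | mul_X p i hp => rw [map_mul, hp]; simp [φ]
  have hlt : RingHom.ker (φ Finset.univ) < RingHom.ker ((Polynomial.evalRingHom 0).comp
      (eval (fun i => (Polynomial.C (a i) : Polynomial k)))) := by
    refine lt_of_le_of_ne (fun p hp => ?_) (fun h => ?_)
    · rw [RingHom.mem_ker, hφ, map_eq_zero_iff _ (C_injective _ _)] at hp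
      rw [RingHom.mem_ker, RingHom.comp_apply, hp, map_zero]
    · have hx : (C Polynomial.X : MvPolynomial σ (Polynomial k)) ∈ RingHom.ker
          ((Polynomial.evalRingHom 0).comp
            (eval (fun i => (Polynomial.C (a i) : Polynomial k)))) := by
        simp [RingHom.mem_ker]
      rw [← h, RingHom.mem_ker, hφ, map_eq_zero_iff _ (C_injective _ _)] at hx
      simp at hx
  have := key Finset.univ
  rw [Finset.card_univ] at this
  push_cast
  exact (add_le_add_left this 1).trans (Ideal.height_add_one_le_of_lt_of_isPrime hlt)

/-- The one-parameter deformation `f_i + t x_i ^ d_i` of a system of polynomials `f_i`; the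
parameter `t` is the variable of the coefficient ring `k[t]`. -/
noncomputable def deformation (f : σ → MvPolynomial σ k) (d : σ → ℕ) (i : σ) :
    MvPolynomial σ (Polynomial k) :=
  C Polynomial.X * X i ^ d i + map Polynomial.C (f i)

/-- Up to a nonzero factor in `k[t]`, polynomials of bounded degree are combinations of the
monomials with all exponents `a_i < d_i`, modulo the deformed system. The rewriting rule
`t x_i ^ d_i ↦ -f_i` yields a square linear system whose matrix is a characteristic matrix, so the
factor can be taken to be a (monic) characteristic polynomial. -/
theorem exists_smul_mem_span_reduced_sup_deformation [Fintype σ] (f : σ → MvPolynomial σ k)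
    (d : σ → ℕ) (hf : ∀ i, (f i).totalDegree ≤ d i) (D : ℕ) :
    ∃ χ : Polynomial k, χ ≠ 0 ∧ ∀ a : σ →₀ ℕ, a.degree ≤ D →
      χ • (monomial a 1 : MvPolynomial σ (Polynomial k)) ∈
        Submodule.span (Polynomial k) (Set.range fun r : (i : σ) → Fin (d i) =>
          (monomial (Finsupp.equivFunOnFinite.symm fun i => (r i : ℕ)) 1 :
            MvPolynomial σ (Polynomial k))) ⊔
        (Ideal.span (Set.range (deformation f d))).restrictScalars (Polynomial k) := by
  classical
  set W := Submodule.span (Polynomial k) (Set.range fun r : (i : σ) → Fin (d i) =>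
          (monomial (Finsupp.equivFunOnFinite.symm fun i => (r i : ℕ)) 1 :
            MvPolynomial σ (Polynomial k))) ⊔
        (Ideal.span (Set.range (deformation f d))).restrictScalars (Polynomial k) with hW
  let A := {a : σ →₀ ℕ // a.degree ≤ D}
  have : Finite A := (Finsupp.finite_of_degree_le D).to_subtype
  have := Fintype.ofFinite A
  -- rewriting rule: a monomial divisible by some `x_i ^ d_i` is traded for a multiple of `f_i`
  have hex : ∀ a : A, ∃ N : A → k,
      C Polynomial.X * (monomial a.1 1 : MvPolynomial σ (Polynomial k)) +
        ∑ b : A, C (Polynomial.C (N b)) * monomial b.1 1 ∈ W := by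
    intro a
    by_cases ha : ∀ i, a.1 i < d i
    · refine ⟨0, ?_⟩
      have : (monomial a.1 1 : MvPolynomial σ (Polynomial k)) ∈ W := by
        refine Submodule.mem_sup_left (Submodule.subset_span ⟨fun i => ⟨a.1 i, ha i⟩, ?_⟩)
        simp only
        congr 1
        congr 1
        ext i
        simp
      simpa [MvPolynomial.smul_eq_C_mul] using W.smul_mem Polynomial.X this
    · push Not at ha
      obtain ⟨i, hi⟩ := ha
      set c := a.1 - Finsupp.single i (d i) with hc
      have hac : a.1 = c + Finsupp.single i (d i) := by
        rw [hc, tsub_add_cancel_of_le]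
        simpa using hi
      have hdeg : c.degree + d i ≤ D := by
        have := a.2
        rw [hac, map_add, Finsupp.degree_single] at this
        exact this
      set q := monomial c 1 * f i with hq
      have hqdeg : ∀ b ∈ q.support, b.degree ≤ D := by
        intro b hb
        have h1 := le_totalDegree hb
        have h2 : q.totalDegree ≤ c.degree + d i := by
          refine (totalDegree_mul _ _).trans (add_le_add ?_ (hf i))
          rw [totalDegree_monomial _ one_ne_zero]
          rfl
        exact h1.trans (h2.trans hdeg)
      refine ⟨fun b => q.coeff b.1, ?_⟩
      have hsum : ∑ b : A, C (Polynomial.C (q.coeff b.1)) * monomial b.1 1 =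
          map Polynomial.C q := by
        conv_rhs => rw [q.as_sum, map_sum]
        have h1 : ∑ b ∈ q.support, map Polynomial.C (monomial b (q.coeff b)) =
            ∑ b ∈ (Finsupp.finite_of_degree_le (σ := σ) D).toFinset,
              map Polynomial.C (monomial b (q.coeff b)) := by
          apply Finset.sum_subset
          · intro b hb
            simpa using hqdeg b hb
          · intro b _ hb
            rw [notMem_support_iff.mp hb]
            simp
        rw [h1, ← Finset.sum_subtype (F := inferInstance)
          (Finsupp.finite_of_degree_le (σ := σ) D).toFinset (by simp)
          (fun b => C (Polynomial.C (q.coeff b)) * monomial b 1)]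
        refine Finset.sum_congr rfl fun b _ => ?_
        rw [map_monomial, C_mul_monomial, mul_one]
      rw [hsum]
      refine Submodule.mem_sup_right ?_
      rw [Submodule.restrictScalars_mem]
      have : C Polynomial.X * (monomial a.1 1 : MvPolynomial σ (Polynomial k)) +
          map Polynomial.C q = monomial c 1 * deformation f d i := by
        rw [hac, deformation, hq, map_mul, map_monomial, Polynomial.C_1, X_pow_eq_monomial,
          mul_add, mul_left_comm, monomial_mul, one_mul]
      rw [this]
      exact Ideal.mul_mem_left _ _ (Ideal.subset_span ⟨i, rfl⟩)
  choose N hN using hex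
  let M : Matrix A A k := Matrix.of fun a b => - N a b
  refine ⟨M.charpoly, M.charpoly_monic.ne_zero, fun a ha => ?_⟩
  have hrow : ∀ a : A, ∑ b, M.charmatrix a b • (monomial b.1 1 : MvPolynomial σ (Polynomial k))
      ∈ W := by
    intro a
    convert hN a using 1
    simp only [Matrix.charmatrix_apply, Matrix.diagonal_apply, M, Matrix.of_apply, map_neg,
      sub_neg_eq_add, add_smul, ite_smul, zero_smul, Finset.sum_add_distrib]
    rw [Finset.sum_ite_eq, if_pos (Finset.mem_univ _)]
    simp only [smul_eq_C_mul]
  have hadj : M.charpoly • (monomial a 1 : MvPolynomial σ (Polynomial k)) =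
      ∑ c, M.charmatrix.adjugate ⟨a, ha⟩ c •
        ∑ b, M.charmatrix c b • (monomial b.1 1 : MvPolynomial σ (Polynomial k)) := by
    have h1 : ∀ b : A, ∑ c, M.charmatrix.adjugate ⟨a, ha⟩ c * M.charmatrix c b =
        if (⟨a, ha⟩ : A) = b then M.charpoly else 0 := by
      intro b
      have := congrFun (congrFun (Matrix.adjugate_mul M.charmatrix) ⟨a, ha⟩) b
      rw [Matrix.mul_apply] at this
      rw [this]
      simp [Matrix.one_apply, Matrix.charpoly]
    simp_rw [Finset.smul_sum, smul_smul]
    rw [Finset.sum_comm]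
    simp_rw [← Finset.sum_smul, h1, ite_smul, zero_smul]
    rw [Finset.sum_ite_eq, if_pos (Finset.mem_univ _)]
  rw [hadj]
  exact W.sum_mem fun c _ => W.smul_mem _ (hrow c)

/-- More than `∏ d_i` polynomials are linearly dependent over `k[t]` modulo the deformed system. -/
theorem exists_sum_smul_mem_span_deformation [Fintype σ] {ι : Type*} [Fintype ι]
    (f : σ → MvPolynomial σ k)
    (d : σ → ℕ) (hf : ∀ i, (f i).totalDegree ≤ d i) (hι : ∏ i, d i < Fintype.card ι)
    (e : ι → MvPolynomial σ (Polynomial k)) :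
    ∃ q : ι → Polynomial k, q ≠ 0 ∧
      ∑ m, C (q m) * e m ∈ Ideal.span (Set.range (deformation f d)) := by
  classical
  obtain ⟨χ, hχ, hmem⟩ := exists_smul_mem_span_reduced_sup_deformation f d hf
    (Finset.univ.sup fun m => (e m).totalDegree)
  set r : ((i : σ) → Fin (d i)) → MvPolynomial σ (Polynomial k) := fun r =>
    monomial (Finsupp.equivFunOnFinite.symm fun i => (r i : ℕ)) 1 with hr
  set I := Ideal.span (Set.range (deformation f d)) with hI
  have hχe : ∀ m, χ • e m ∈ Submodule.span (Polynomial k) (Set.range r) ⊔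
      I.restrictScalars (Polynomial k) := by
    intro m
    conv => enter [2]; rw [(e m).as_sum, Finset.smul_sum]
    refine Submodule.sum_mem _ fun a ha => ?_
    have : χ • monomial a ((e m).coeff a) = (e m).coeff a • (χ • monomial a 1 :
        MvPolynomial σ (Polynomial k)) := by
      rw [smul_comm, smul_monomial (r := (e m).coeff a), smul_eq_mul, mul_one]
    rw [this]
    refine Submodule.smul_mem _ _ (hmem a ?_)
    exact (le_totalDegree ha).trans
      (Finset.le_sup (f := fun m => (e m).totalDegree) (Finset.mem_univ m))
  have hex : ∀ m, ∃ c : ((i : σ) → Fin (d i)) → Polynomial k, χ • e m - ∑ s, c s • r s ∈ I := by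
    intro m
    obtain ⟨u, hu, v, hv, huv⟩ := Submodule.mem_sup.mp (hχe m)
    obtain ⟨c, hc⟩ := (Submodule.mem_span_range_iff_exists_fun _).mp hu
    refine ⟨c, ?_⟩
    rw [hc, ← huv, add_sub_cancel_left]
    exact hv
  choose c hc using hex
  have hdep : ¬ LinearIndependent (Polynomial k) c := by
    intro h
    have := h.fintype_card_le_finrank
    rw [Module.finrank_fintype_fun_eq_card, Fintype.card_pi] at this
    simp at this
    omega
  obtain ⟨q, hq0, m, hm⟩ := Fintype.not_linearIndependent_iff.mp hdep
  refine ⟨fun m => q m * χ, fun h => ?_, ?_⟩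
  · have := congrFun h m
    simp only [Pi.zero_apply, mul_eq_zero, hχ, or_false] at this
    exact hm this
  · have h1 : ∑ m, q m • ∑ s, c m s • r s = 0 := by
      simp_rw [Finset.smul_sum, smul_smul]
      rw [Finset.sum_comm]
      simp_rw [← Finset.sum_smul]
      refine Finset.sum_eq_zero fun s _ => ?_
      have := congrFun hq0 s
      simp only [Finset.sum_apply, Pi.smul_apply, smul_eq_mul, Pi.zero_apply] at this
      rw [this, zero_smul]
    have h2 : ∑ m, C (q m * χ) * e m = ∑ m, q m • (χ • e m - ∑ s, c m s • r s) := by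
      simp_rw [smul_sub, Finset.sum_sub_distrib]
      rw [h1, sub_zero]
      refine Finset.sum_congr rfl fun m _ => ?_
      rw [smul_smul, smul_eq_C_mul]
    rw [h2]
    refine Ideal.sum_mem _ fun m _ => ?_
    rw [smul_eq_C_mul]
    exact Ideal.mul_mem_left _ _ (hc m)

/-- If the system `f` has finitely many zeros and `t ^ r h` is in the deformed ideal for some `h`
that does not vanish at `(p, 0)`, then `(p, 0)` is an isolated zero of the deformed system: a smaller
prime over the deformed ideal contains `t`, hence the `f_i`, hence by the Nullstellensatz the
maximal ideal of one of the finitely many zeros, which must be `p`. -/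
theorem ker_eval_mem_minimalPrimes_deformation [Fintype σ] [IsAlgClosed k]
    {f : σ → MvPolynomial σ k} {d : σ → ℕ} (hfin : {x : σ → k | ∀ i, eval x (f i) = 0}.Finite) {p : σ → k}
    (hp : ∀ i, eval p (f i) = 0) {h : MvPolynomial σ (Polynomial k)} {r : ℕ}
    (hmem : C (Polynomial.X ^ r) * h ∈ Ideal.span (Set.range (deformation f d)))
    (hh : h ∉ RingHom.ker ((Polynomial.evalRingHom 0).comp
        (eval (fun i => (Polynomial.C (p i) : Polynomial k))))) :
    RingHom.ker ((Polynomial.evalRingHom 0).comp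
        (eval (fun i => (Polynomial.C (p i) : Polynomial k)))) ∈
      (Ideal.span (Set.range (deformation f d))).minimalPrimes := by
  classical
  set ev := (Polynomial.evalRingHom 0).comp
        (eval (fun i => (Polynomial.C (p i) : Polynomial k))) with hev
  have hevmap : ∀ g : MvPolynomial σ k, ev (map Polynomial.C g) = eval p g := by
    intro g
    rw [hev, RingHom.comp_apply, eval_map, eval₂_eq_eval_map]
    induction g using MvPolynomial.induction_on with
    | C r => simp
    | add p q hp hq => simp only [map_add, hp, hq]
    | mul_X p i hp => simp only [map_mul, hp, map_X, eval_X]; simp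
  have hm : (RingHom.ker ev).IsPrime := RingHom.ker_isPrime _
  refine ⟨⟨hm, ?_⟩, ?_⟩
  · rw [Ideal.span_le]
    rintro _ ⟨i, rfl⟩
    rw [SetLike.mem_coe, RingHom.mem_ker, deformation, map_add, hevmap, hp i]
    simp [hev]
  · rintro q ⟨hq, hIq⟩ hle
    have hX : C Polynomial.X ∈ q := by
      rcases hq.mem_or_mem (hIq hmem) with h1 | h1
      · rw [map_pow] at h1
        exact hq.mem_of_pow_mem _ h1
      · exact absurd (hle h1) hh
    have hfq : ∀ i, map Polynomial.C (f i) ∈ q := by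
      intro i
      have h1 : deformation f d i ∈ q := hIq (Ideal.subset_span ⟨i, rfl⟩)
      rw [deformation] at h1
      exact (Ideal.add_mem_iff_right _ (Ideal.mul_mem_right _ _ hX)).mp h1
    have hsub : ∀ i, (X i - C (Polynomial.C (p i)) : MvPolynomial σ (Polynomial k)) ∈ q := by
      intro i
      set u : MvPolynomial σ k := ∏ z ∈ hfin.toFinset, (X i - C (z i)) with hu
      have hrad : u ∈ (Ideal.span (Set.range f)).radical := by
        rw [← vanishingIdeal_zeroLocus_eq_radical (K := k), mem_vanishingIdeal_iff]
        intro x hx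
        rw [zeroLocus_span] at hx
        have hx' : x ∈ hfin.toFinset := by
          rw [Set.Finite.mem_toFinset]
          intro m
          have := hx (f m) ⟨m, rfl⟩
          rwa [aeval_eq_eval] at this
        rw [hu, map_prod]
        exact Finset.prod_eq_zero hx' (by simp)
      obtain ⟨N, hN⟩ := hrad
      have h1 : map Polynomial.C u ∈ q := by
        apply hq.mem_of_pow_mem N
        rw [← map_pow]
        have : (Ideal.span (Set.range f)).map (map Polynomial.C) ≤ q := by
          rw [Ideal.map_span, Ideal.span_le]
          rintro _ ⟨_, ⟨m, rfl⟩, rfl⟩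
          exact hfq m
        exact this (Ideal.mem_map_of_mem _ hN)
      rw [hu, map_prod] at h1
      obtain ⟨z, -, hz⟩ := (Ideal.IsPrime.prod_mem_iff (hp := hq)).mp h1
      have hz2 := hle hz
      rw [RingHom.mem_ker, hevmap] at hz2
      have : p i = z i := by simpa [sub_eq_zero] using hz2
      rw [this]
      simpa using hz
    -- every polynomial is congruent to its value at `(p, 0)` modulo `q`
    have hcong : ∀ g : MvPolynomial σ (Polynomial k), g - C (Polynomial.C (ev g)) ∈ q := by
      intro g
      induction g using MvPolynomial.induction_on with
      | C r =>
        have h1 : (C r : MvPolynomial σ (Polynomial k)) - C (Polynomial.C (ev (C r))) =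
            C Polynomial.X * C r.divX := by
          rw [← C_mul, ← C_sub]
          congr 1
          have h2 : ev (C r) = r.coeff 0 := by simp [hev, Polynomial.coeff_zero_eq_eval_zero]
          rw [h2, sub_eq_iff_eq_add, mul_comm]
          exact (Polynomial.divX_mul_X_add r).symm
        rw [h1]
        exact Ideal.mul_mem_right _ _ hX
      | add a b ha hb =>
        have := q.add_mem ha hb
        rw [map_add, map_add, map_add]
        convert this using 1
        ring
      | mul_X a i ha =>
        have h1 := q.add_mem (q.mul_mem_right (X i) ha)
          (q.mul_mem_left (C (Polynomial.C (ev a))) (hsub i))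
        have h2 : ev (X i) = p i := by simp [hev]
        rw [map_mul, h2, map_mul, map_mul]
        convert h1 using 1
        ring
    intro g hg
    have := hcong g
    rw [RingHom.mem_ker.mp hg] at this
    simpa using this

theorem exists_eval_eq_ite [Fintype σ] (Z : Finset (σ → k)) (z : σ → k) :
    ∃ e : MvPolynomial σ k, eval z e = 1 ∧ ∀ w ∈ Z, w ≠ z → eval w e = 0 := by
  classical
  have : ∀ w : σ → k, ∃ e : MvPolynomial σ k, eval z e = 1 ∧ (w ≠ z → eval w e = 0) := by
    intro w
    by_cases hw : w = z
    · exact ⟨1, by simp, fun h => absurd hw h⟩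
    · obtain ⟨i, hi⟩ := Function.ne_iff.mp hw
      refine ⟨C (z i - w i)⁻¹ * (X i - C (w i)), ?_, fun _ => by simp⟩
      simp [inv_mul_cancel₀ (sub_ne_zero.mpr (Ne.symm hi))]
  choose e he1 he2 using this
  refine ⟨∏ w ∈ Z, e w, ?_, fun w hw hwz => ?_⟩
  · rw [map_prod]
    exact Finset.prod_eq_one fun w _ => he1 w
  · rw [map_prod]
    exact Finset.prod_eq_zero hw (he2 w hwz)

/-- **Affine Bézout inequality**: as many polynomials as variables, if they have finitely many
common zeros, have at most as many of them as the product of the degrees. -/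
theorem ncard_zeros_le_prod_degree [Fintype σ] [IsAlgClosed k] (f : σ → MvPolynomial σ k)
    (d : σ → ℕ) (hf : ∀ i, (f i).totalDegree ≤ d i)
    (hfin : {x : σ → k | ∀ i, eval x (f i) = 0}.Finite) :
    {x : σ → k | ∀ i, eval x (f i) = 0}.ncard ≤ ∏ i, d i := by
  classical
  by_contra! hlt
  rw [Set.ncard_eq_toFinset_card _ hfin] at hlt
  set Z := hfin.toFinset with hZ
  choose e he1 he2 using fun z : Z => exists_eval_eq_ite Z z.1
  obtain ⟨q, hq0, hq⟩ := exists_sum_smul_mem_span_deformation (ι := Z) f d hf (by simpa using hlt)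
    (fun z => map Polynomial.C (e z))
  -- divide the relation by the largest power of `t` that divides all its coefficients
  have hpow : ∃ r : ℕ, ∃ q' : Z → Polynomial k, (∀ z, q z = Polynomial.X ^ r * q' z) ∧
      ∃ z, (q' z).eval 0 ≠ 0 := by
    obtain ⟨z0, hz0⟩ := Function.ne_iff.mp hq0
    have hb : ∀ r, (∀ z, Polynomial.X ^ r ∣ q z) → r ≤ (q z0).natDegree := fun r hr => by
      simpa using Polynomial.natDegree_le_of_dvd (hr z0) hz0
    have hP0 : ∀ z, Polynomial.X ^ 0 ∣ q z := fun z => by simp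
    let r := Nat.findGreatest (fun r => ∀ z, Polynomial.X ^ r ∣ q z) (q z0).natDegree
    have hr : ∀ z, Polynomial.X ^ r ∣ q z :=
      Nat.findGreatest_spec (P := fun r => ∀ z, Polynomial.X ^ r ∣ q z) (Nat.zero_le _) hP0
    choose q' hq' using hr
    refine ⟨r, q', hq', ?_⟩
    by_contra! hall
    have h1 : ∀ z, Polynomial.X ^ (r + 1) ∣ q z := by
      intro z
      rw [hq' z, pow_succ]
      exact mul_dvd_mul_left _ (Polynomial.X_dvd_iff.mpr
        (by rw [Polynomial.coeff_zero_eq_eval_zero]; exact hall z))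
    have h2 : r + 1 ≤ r := Nat.le_findGreatest
      (P := fun r => ∀ z, Polynomial.X ^ r ∣ q z) (hb _ h1) h1
    omega
  obtain ⟨r, q', hqq', z, hz⟩ := hpow
  have hzZ : ∀ i, eval z.1 (f i) = 0 := hfin.mem_toFinset.mp z.2
  set h := ∑ m, C (q' m) * map Polynomial.C (e m) with hh
  have hmem : C (Polynomial.X ^ r) * h ∈ Ideal.span (Set.range (deformation f d)) := by
    convert hq using 1
    rw [hh, Finset.mul_sum]
    refine Finset.sum_congr rfl fun m _ => ?_
    rw [hqq' m, map_mul, mul_assoc]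
  have hnot : h ∉ RingHom.ker ((Polynomial.evalRingHom 0).comp
        (eval (fun i => (Polynomial.C (z.1 i) : Polynomial k)))) := by
    have hev : ∀ g : MvPolynomial σ k,
        eval (fun i => (Polynomial.C (z.1 i) : Polynomial k)) (map Polynomial.C g) =
          Polynomial.C (eval z.1 g) := by
      intro g
      induction g using MvPolynomial.induction_on with
      | C r => simp
      | add p q hp hq => simp only [map_add, hp, hq]
      | mul_X p i hp => simp only [map_mul, hp, map_X, eval_X]
    rw [RingHom.mem_ker, hh, map_sum, Finset.sum_eq_single z]
    · simpa [hev, he1] using hz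
    · intro m _ hm
      simp [hev, he2 m z.1 z.2 (fun h => hm (Subtype.ext h.symm))]
    · simp
  have hmin := ker_eval_mem_minimalPrimes_deformation hfin hzZ hmem hnot
  have h1 := Ideal.height_le_card_of_mem_minimalPrimes_span (Set.finite_range _) hmin
  have h2 := (card_succ_le_height_ker_eval z.1).trans h1
  have h3 : (Set.range (deformation f d)).ncard ≤ Fintype.card σ := by
    rw [← Set.image_univ]
    exact (Set.ncard_image_le Set.finite_univ).trans (by simp [Set.ncard_univ])
  have h4 : Fintype.card σ + 1 ≤ (Set.range (deformation f d)).ncard := by exact_mod_cast h2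
  omega

end Bezout

/-! ### Faces of a polyhedron in general position -/

namespace GaleSystem

variable {n ℓ : ℕ}

/-- The linear part `L_i` of the affine form `Λ_i`. -/
def linForm (G : GaleSystem n ℓ) (i : Fin (n + ℓ + 1)) : (Fin ℓ → ℝ) →ₗ[ℝ] ℝ :=
  LinearMap.proj i ∘ₗ G.L.mulVecLin

theorem form_eq_linForm_add (G : GaleSystem n ℓ) (i : Fin (n + ℓ + 1)) (y : Fin ℓ → ℝ) :
    G.form i y = G.linForm i y + G.lam i := rfl

theorem form_add (G : GaleSystem n ℓ) (i : Fin (n + ℓ + 1)) (y d : Fin ℓ → ℝ) :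
    G.form i (y + d) = G.form i y + G.linForm i d := by
  simp only [form_eq_linForm_add, map_add]
  ring

theorem form_add_smul (G : GaleSystem n ℓ) (i : Fin (n + ℓ + 1)) (y d : Fin ℓ → ℝ) (t : ℝ) :
    G.form i (y + t • d) = G.form i y + t * G.linForm i d := by
  rw [form_add, map_smul, smul_eq_mul]

theorem linForm_sub (G : GaleSystem n ℓ) (i : Fin (n + ℓ + 1)) (y z : Fin ℓ → ℝ) :
    G.linForm i (y - z) = G.form i y - G.form i z := by
  simp only [form_eq_linForm_add, map_sub]
  ring

theorem form_segment (G : GaleSystem n ℓ) (i : Fin (n + ℓ + 1)) (y z : Fin ℓ → ℝ) {a b : ℝ}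
    (hab : a + b = 1) : G.form i (a • y + b • z) = a * G.form i y + b * G.form i z := by
  simp only [form_eq_linForm_add, map_add, map_smul, smul_eq_mul]
  linear_combination (-G.lam i) * hab

theorem continuous_linForm (G : GaleSystem n ℓ) (i : Fin (n + ℓ + 1)) :
    Continuous (G.linForm i) := LinearMap.continuous_of_finiteDimensional _

theorem continuous_form (G : GaleSystem n ℓ) (i : Fin (n + ℓ + 1)) : Continuous (G.form i) :=
  (G.continuous_linForm i).add continuous_const

theorem isOpen_chamber (G : GaleSystem n ℓ) : IsOpen G.chamber := by
  have : G.chamber = ⋂ i, {y | 0 < G.form i y} := by ext; simp [chamber]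
  rw [this]
  exact isOpen_iInter_of_finite fun i => isOpen_lt continuous_const (G.continuous_form i)

theorem convex_chamber (G : GaleSystem n ℓ) : Convex ℝ G.chamber := by
  intro y hy z hz a b ha hb hab i
  rw [form_segment _ _ _ _ hab]
  rcases ha.eq_or_lt with rfl | ha
  · rw [zero_add] at hab
    simpa [hab] using hz i
  · exact add_pos_of_pos_of_nonneg (mul_pos ha (hy i)) (mul_nonneg hb (hz i).le)

theorem mem_closure_chamber {G : GaleSystem n ℓ} (hne : G.chamber.Nonempty) {y : Fin ℓ → ℝ} :
    y ∈ closure G.chamber ↔ ∀ i, 0 ≤ G.form i y := by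
  constructor
  · intro hy i
    have : closure G.chamber ⊆ {y | 0 ≤ G.form i y} :=
      closure_minimal (fun z hz => (hz i).le) (isClosed_le continuous_const (G.continuous_form i))
    exact this hy
  · intro hy
    obtain ⟨z, hz⟩ := hne
    have hlim : Filter.Tendsto (fun t : ℝ => y + t • (z - y)) (nhdsWithin 0 (Set.Ioo 0 1))
        (nhds y) := by
      have : Continuous (fun t : ℝ => y + t • (z - y)) := by fun_prop
      have h := this.tendsto 0
      simp only [zero_smul, add_zero] at h
      exact h.mono_left nhdsWithin_le_nhds
    have hne : (nhdsWithin (0 : ℝ) (Set.Ioo 0 1)).NeBot := by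
      rw [← mem_closure_iff_nhdsWithin_neBot, closure_Ioo zero_ne_one]
      simp
    refine mem_closure_of_tendsto hlim ?_
    filter_upwards [self_mem_nhdsWithin] with t ht i
    rw [form_add_smul, linForm_sub]
    have h1 : G.form i y + t * (G.form i z - G.form i y) =
      (1 - t) * G.form i y + t * G.form i z := by ring
    rw [h1]
    exact add_pos_of_nonneg_of_pos (mul_nonneg (by linarith [ht.2]) (hy i)) (mul_pos ht.1 (hz i))

open Classical in
/-- The set of (indices of) forms that vanish at `p`. -/
noncomputable def active (G : GaleSystem n ℓ) (p : Fin ℓ → ℝ) : Finset (Fin (n + ℓ + 1)) :=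
  Finset.univ.filter fun i => G.form i p = 0

theorem mem_active {G : GaleSystem n ℓ} {p : Fin ℓ → ℝ} {i : Fin (n + ℓ + 1)} :
    i ∈ G.active p ↔ G.form i p = 0 := by
  simp [active]

open Classical in
/-- The set of (indices of) forms that vanish identically on `P`. -/
noncomputable def rows (G : GaleSystem n ℓ) (P : Set (Fin ℓ → ℝ)) : Finset (Fin (n + ℓ + 1)) :=
  Finset.univ.filter fun i => ∀ p ∈ P, G.form i p = 0

theorem mem_rows {G : GaleSystem n ℓ} {P : Set (Fin ℓ → ℝ)} {i : Fin (n + ℓ + 1)} :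
    i ∈ G.rows P ↔ ∀ p ∈ P, G.form i p = 0 := by
  simp [rows]

/-- The part of the closed polyhedron on which the forms with index in `I` vanish. -/
def faceOf (G : GaleSystem n ℓ) (I : Finset (Fin (n + ℓ + 1))) : Set (Fin ℓ → ℝ) :=
  {y ∈ closure G.chamber | ∀ i ∈ I, G.form i y = 0}

theorem mem_frontier_chamber {G : GaleSystem n ℓ} (hne : G.chamber.Nonempty) {y : Fin ℓ → ℝ} :
    y ∈ frontier G.chamber ↔ y ∈ closure G.chamber ∧ (G.active y).Nonempty := by
  rw [G.isOpen_chamber.frontier_eq, Set.mem_sdiff]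
  refine and_congr_right fun hy => ?_
  rw [mem_closure_chamber hne] at hy
  simp only [chamber, Set.mem_ofPred_eq, not_forall, not_lt, Finset.Nonempty, mem_active]
  exact exists_congr fun i => ⟨fun h => le_antisymm h (hy i), fun h => h.le⟩

theorem isExposed_faceOf {G : GaleSystem n ℓ} (hne : G.chamber.Nonempty)
    (I : Finset (Fin (n + ℓ + 1))) : IsExposed ℝ (closure G.chamber) (G.faceOf I) := by
  rintro ⟨p, hpK, hp⟩
  refine ⟨LinearMap.toContinuousLinearMap (-∑ i ∈ I, G.linForm i), ?_⟩
  have hl : ∀ y, (LinearMap.toContinuousLinearMap (-∑ i ∈ I, G.linForm i)) y =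
      ∑ i ∈ I, G.lam i - ∑ i ∈ I, G.form i y := by
    intro y
    simp [form_eq_linForm_add, Finset.sum_add_distrib]
  ext y
  simp only [faceOf, Set.mem_ofPred_eq, hl]
  refine and_congr_right fun hy => ⟨fun h z hz => ?_, fun h => ?_⟩
  · rw [Finset.sum_eq_zero h]
    have : 0 ≤ ∑ i ∈ I, G.form i z :=
      Finset.sum_nonneg fun i _ => (mem_closure_chamber hne).mp hz i
    linarith
  · have h1 := h p hpK
    rw [Finset.sum_eq_zero hp] at h1
    have h2 : ∀ i ∈ I, 0 ≤ G.form i y := fun i _ => (mem_closure_chamber hne).mp hy i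
    have h3 : ∑ i ∈ I, G.form i y = 0 := le_antisymm (by linarith) (Finset.sum_nonneg h2)
    exact (Finset.sum_eq_zero_iff_of_nonneg h2).mp h3

theorem exists_extremePoint_active {G : GaleSystem n ℓ} (hne : G.chamber.Nonempty)
    (hbd : Bornology.IsBounded G.chamber) {p : Fin ℓ → ℝ} (hp : p ∈ closure G.chamber) :
    ∃ q ∈ (closure G.chamber).extremePoints ℝ, G.active p ⊆ G.active q := by
  have hexp := isExposed_faceOf hne (G.active p)
  have hK : IsCompact (closure G.chamber) := hbd.isCompact_closure
  have hne' : (G.faceOf (G.active p)).Nonempty := ⟨p, hp, fun i hi => mem_active.mp hi⟩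
  obtain ⟨q, hq⟩ := (hexp.isCompact hK).extremePoints_nonempty hne'
  refine ⟨q, hexp.isExtreme.extremePoints_subset_extremePoints hq, fun i hi => ?_⟩
  exact mem_active.mpr (hq.1.2 i hi)

/-- Moving from a point of the closed polyhedron in a direction along which no active form
decreases stays in the polyhedron for a short time. -/
theorem exists_pos_add_smul_mem {G : GaleSystem n ℓ} (hne : G.chamber.Nonempty) {p d : Fin ℓ → ℝ}
    (hp : p ∈ closure G.chamber) (hd : ∀ i ∈ G.active p, 0 ≤ G.linForm i d) :
    ∃ ε > (0 : ℝ), p + ε • d ∈ closure G.chamber := by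
  have hev : ∀ᶠ t in nhdsWithin (0 : ℝ) (Set.Ioi 0), ∀ i, 0 ≤ G.form i (p + t • d) := by
    rw [Filter.eventually_all]
    intro i
    by_cases hi : i ∈ G.active p
    · filter_upwards [self_mem_nhdsWithin] with t ht
      rw [form_add_smul, mem_active.mp hi, zero_add]
      exact mul_nonneg (le_of_lt ht) (hd i hi)
    · have hpos : 0 < G.form i p := lt_of_le_of_ne ((mem_closure_chamber hne).mp hp i)
        (fun h => hi (mem_active.mpr h.symm))
      have hc : Continuous fun t : ℝ => G.form i (p + t • d) :=
        (G.continuous_form i).comp (by fun_prop)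
      have h0 : 0 < G.form i (p + (0 : ℝ) • d) := by simpa using hpos
      exact (((hc.tendsto 0).eventually (lt_mem_nhds h0)).filter_mono nhdsWithin_le_nhds).mono
        fun t ht => ht.le
  obtain ⟨t, ht, ht0⟩ := (hev.and self_mem_nhdsWithin).exists
  exact ⟨t, ht0, (mem_closure_chamber hne).mpr ht⟩

theorem eq_zero_of_extremePoint {G : GaleSystem n ℓ} (hne : G.chamber.Nonempty) {q d : Fin ℓ → ℝ}
    (hq : q ∈ (closure G.chamber).extremePoints ℝ) (hd : ∀ i ∈ G.active q, G.linForm i d = 0) :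
    d = 0 := by
  obtain ⟨ε, hε, h1⟩ := exists_pos_add_smul_mem hne hq.1 (fun i hi => (hd i hi).ge)
  obtain ⟨δ, hδ, h2⟩ := exists_pos_add_smul_mem (d := -d) hne hq.1
    (fun i hi => by rw [map_neg, hd i hi, neg_zero])
  have hmem : q ∈ openSegment ℝ (q + ε • d) (q + δ • -d) := by
    refine ⟨δ / (ε + δ), ε / (ε + δ), by positivity, by positivity,
      by rw [← add_div, add_comm, div_self (by positivity)], ?_⟩
    ext c
    simp only [Pi.add_apply, Pi.smul_apply, smul_eq_mul, Pi.neg_apply]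
    field_simp
    ring
  have := hq.2 h1 h2 hmem
  have h3 : ε • d = 0 := by simpa using this
  exact (smul_eq_zero.mp h3).resolve_left hε.ne'

/-- In general position the forms active at a point of the closed polyhedron have independent
linear parts; equivalently, these linear parts take prescribed values at a suitable vector. -/
theorem exists_linForm_eq {G : GaleSystem n ℓ} (hne : G.chamber.Nonempty)
    (hbd : Bornology.IsBounded G.chamber) (h1 : G.GeneralPosition) {p : Fin ℓ → ℝ}
    (hp : p ∈ closure G.chamber) (c : Fin (n + ℓ + 1) → ℝ) :
    ∃ d, ∀ i ∈ G.active p, G.linForm i d = c i := by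
  obtain ⟨q, hq, hpq⟩ := exists_extremePoint_active hne hbd hp
  let φ : (Fin ℓ → ℝ) →ₗ[ℝ] (G.active q → ℝ) := LinearMap.pi fun i => G.linForm i
  have hinj : Function.Injective φ := by
    rw [← LinearMap.ker_eq_bot, LinearMap.ker_eq_bot']
    intro d hd
    exact eq_zero_of_extremePoint hne hq fun i hi => congrFun hd ⟨i, hi⟩
  have hcard : (G.active q).card = ℓ := by
    have h := h1 q hq
    have h' : {i | G.form i q = 0} = (G.active q : Set (Fin (n + ℓ + 1))) := by
      ext i
      simp [mem_active]
    rwa [h', Set.ncard_coe_finset] at h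
  have hsurj : Function.Surjective φ :=
    (LinearMap.injective_iff_surjective_of_finrank_eq_finrank (by simp [hcard])).mp hinj
  obtain ⟨d, hd⟩ := hsurj fun i => c i
  exact ⟨d, fun i hi => congrFun hd ⟨i, hpq hi⟩⟩

/-- A face has a point at which only the forms vanishing on the whole face vanish. -/
theorem exists_mem_active_eq_rows {G : GaleSystem n ℓ} (hne : G.chamber.Nonempty)
    {P : Set (Fin ℓ → ℝ)} (hP : G.IsFace P) : ∃ q ∈ P, G.active q = G.rows P := by
  classical
  have hconv : Convex ℝ P := hP.2.convex G.convex_chamber.closure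
  have hsub : P ⊆ closure G.chamber := hP.2.subset
  have key : ∀ s : Finset (Fin (n + ℓ + 1)), Disjoint s (G.rows P) →
      ∃ q ∈ P, ∀ i ∈ s, 0 < G.form i q := by
    intro s
    induction s using Finset.induction_on with
    | empty => exact fun _ => ⟨hP.1.some, hP.1.some_mem, by simp⟩
    | insert i s hi ih =>
      intro hdis
      rw [Finset.disjoint_insert_left] at hdis
      obtain ⟨q, hq, hqs⟩ := ih hdis.2
      have hi' := hdis.1
      rw [mem_rows] at hi'
      push Not at hi'
      obtain ⟨r, hr, hr0⟩ := hi'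
      refine ⟨(1 / 2 : ℝ) • q + (1 / 2 : ℝ) • r, hconv hq hr (by norm_num) (by norm_num)
        (by norm_num), fun m hm => ?_⟩
      rw [form_segment _ _ _ _ (by norm_num)]
      have hq0 := (mem_closure_chamber hne).mp (hsub hq) m
      have hr1 := (mem_closure_chamber hne).mp (hsub hr) m
      rcases Finset.mem_insert.mp hm with rfl | hm
      · have := lt_of_le_of_ne hr1 (Ne.symm hr0)
        linarith
      · have := hqs m hm
        linarith
  obtain ⟨q, hq, hqs⟩ := key (Finset.univ \ G.rows P) Finset.sdiff_disjoint
  refine ⟨q, hq, Finset.Subset.antisymm (fun i hi => ?_) (fun i hi => ?_)⟩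
  · by_contra h
    exact (hqs i (by simp [h])).ne' (mem_active.mp hi)
  · exact mem_active.mpr (mem_rows.mp hi q hq)

/-- A face is cut out by the forms that vanish on it: the functional exposing it is maximal at a
relative interior point `q`, and a point `y` with the same vanishing forms can be reflected a little
beyond `q`. -/
theorem face_eq_faceOf_rows {G : GaleSystem n ℓ} (hne : G.chamber.Nonempty)
    {P : Set (Fin ℓ → ℝ)} (hP : G.IsFace P) : P = G.faceOf (G.rows P) := by
  refine Set.Subset.antisymm (fun y hy => ⟨hP.2.subset hy, fun i hi => mem_rows.mp hi y hy⟩) ?_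
  rintro y ⟨hyK, hy⟩
  obtain ⟨q, hq, hqr⟩ := exists_mem_active_eq_rows hne hP
  obtain ⟨l, hl⟩ := hP.2 hP.1
  have hqK : q ∈ closure G.chamber := hP.2.subset hq
  obtain ⟨ε, hε, hmem⟩ := exists_pos_add_smul_mem (d := q - y) hne hqK (fun i hi => by
    rw [linForm_sub, mem_active.mp hi, hy i (hqr ▸ hi), sub_zero])
  rw [hl] at hq ⊢
  have h1 := hq.2 _ hmem
  rw [map_add, map_smul, map_sub, smul_eq_mul] at h1
  have h2 : l q ≤ l y := by
    by_contra! hlt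
    have := mul_pos hε (sub_pos.mpr hlt)
    linarith
  exact ⟨hyK, fun z hz => (hq.2 z hz).trans h2⟩

theorem direction_affineSpan_face {G : GaleSystem n ℓ} (hne : G.chamber.Nonempty)
    {P : Set (Fin ℓ → ℝ)} (hP : G.IsFace P) :
    (affineSpan ℝ P).direction = LinearMap.ker (LinearMap.pi fun i : G.rows P => G.linForm i) := by
  obtain ⟨q, hq, hqr⟩ := exists_mem_active_eq_rows hne hP
  refine le_antisymm ?_ fun d hd => ?_
  · rw [direction_affineSpan, vectorSpan_def, Submodule.span_le]
    rintro _ ⟨y, hy, z, hz, rfl⟩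
    rw [SetLike.mem_coe, LinearMap.mem_ker]
    ext i
    simp only [LinearMap.pi_apply, Pi.zero_apply, vsub_eq_sub, linForm_sub]
    rw [mem_rows.mp i.2 y hy, mem_rows.mp i.2 z hz, sub_zero]
  · have hd' : ∀ i ∈ G.rows P, G.linForm i d = 0 := fun i hi =>
      congrFun (LinearMap.mem_ker.mp hd) ⟨i, hi⟩
    obtain ⟨ε, hε, hmem⟩ := exists_pos_add_smul_mem (d := d) hne (hP.2.subset hq)
      (fun i hi => (hd' i (hqr ▸ hi)).ge)
    have hP' : q + ε • d ∈ P := by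
      rw [face_eq_faceOf_rows hne hP]
      refine ⟨hmem, fun i hi => ?_⟩
      rw [form_add_smul, hd' i hi, mem_rows.mp hi q hq]
      ring
    have h2 := AffineSubspace.vsub_mem_direction (subset_affineSpan ℝ P hP')
      (subset_affineSpan ℝ P hq)
    rw [vsub_eq_sub, add_sub_cancel_left] at h2
    exact (Submodule.smul_mem_iff _ hε.ne').mp h2

theorem finrank_direction_add_card_rows {G : GaleSystem n ℓ} (hne : G.chamber.Nonempty)
    (hbd : Bornology.IsBounded G.chamber) (h1 : G.GeneralPosition)
    {P : Set (Fin ℓ → ℝ)} (hP : G.IsFace P) :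
    Module.finrank ℝ (affineSpan ℝ P).direction + (G.rows P).card = ℓ := by
  classical
  obtain ⟨q, hq, hqr⟩ := exists_mem_active_eq_rows hne hP
  rw [direction_affineSpan_face hne hP]
  have hsurj : Function.Surjective (LinearMap.pi fun i : G.rows P => G.linForm i) := by
    intro c
    obtain ⟨d, hd⟩ := exists_linForm_eq hne hbd h1 (hP.2.subset hq)
      (fun i => if h : i ∈ G.rows P then c ⟨i, h⟩ else 0)
    refine ⟨d, ?_⟩
    ext i
    rw [LinearMap.pi_apply, hd i (by rw [hqr]; exact i.2), dif_pos i.2]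
  have := LinearMap.finrank_range_add_finrank_ker (LinearMap.pi fun i : G.rows P => G.linForm i)
  rw [LinearMap.range_eq_top.mpr hsurj, finrank_top] at this
  simp only [Module.finrank_fintype_fun_eq_card, Fintype.card_fin, Fintype.card_coe] at this
  omega

theorem codim_face {G : GaleSystem n ℓ} (hne : G.chamber.Nonempty)
    (hbd : Bornology.IsBounded G.chamber) (h1 : G.GeneralPosition)
    {P : Set (Fin ℓ → ℝ)} (hP : G.IsFace P) : G.codim P = (G.rows P).card := by
  have := finrank_direction_add_card_rows hne hbd h1 hP
  rw [codim]
  omega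

theorem isFace_faceOf {G : GaleSystem n ℓ} (hne : G.chamber.Nonempty) {p : Fin ℓ → ℝ}
    (hp : p ∈ closure G.chamber) {I : Finset (Fin (n + ℓ + 1))} (hI : I ⊆ G.active p) :
    G.IsFace (G.faceOf I) :=
  ⟨⟨p, hp, fun _ hi => mem_active.mp (hI hi)⟩, isExposed_faceOf hne I⟩

/-- In general position every subset of the forms active at a point cuts out a face on which no
further form vanishes identically. -/
theorem rows_faceOf {G : GaleSystem n ℓ} (hne : G.chamber.Nonempty)
    (hbd : Bornology.IsBounded G.chamber) (h1 : G.GeneralPosition) {p : Fin ℓ → ℝ}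
    (hp : p ∈ closure G.chamber) {I : Finset (Fin (n + ℓ + 1))} (hI : I ⊆ G.active p) :
    G.rows (G.faceOf I) = I := by
  classical
  refine Finset.Subset.antisymm (fun i hi => ?_) (fun i hi => mem_rows.mpr fun y hy => hy.2 i hi)
  by_contra hiI
  rw [mem_rows] at hi
  obtain ⟨d, hd⟩ := exists_linForm_eq hne hbd h1 hp (fun m => if m ∈ I then 0 else 1)
  obtain ⟨ε, hε, hmem⟩ := exists_pos_add_smul_mem (d := d) hne hp (fun m hm => by
    rw [hd m hm]; split_ifs <;> norm_num)
  have hip : i ∈ G.active p :=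
    mem_active.mpr (hi p ⟨hp, fun m hm => mem_active.mp (hI hm)⟩)
  have h2 := hi (p + ε • d) ⟨hmem, fun m hm => by
    rw [form_add_smul, hd m (hI hm), if_pos hm, mem_active.mp (hI hm)]; ring⟩
  rw [form_add_smul, hd i hip, if_neg hiI, mem_active.mp hip] at h2
  linarith

/-! ### Nonnegative relations between the rows of the exponent matrix -/

/-- A nontrivial nonnegative relation between the rows with index in `I` of the first `m` columns
of the exponent matrix. -/
def NonnegRelation (G : GaleSystem n ℓ) (m : ℕ) (I : Finset (Fin (n + ℓ + 1))) : Prop :=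
  ∃ v : Fin (n + ℓ + 1) → ℝ, (∀ i ∈ I, 0 ≤ v i) ∧ (∃ i ∈ I, v i ≠ 0) ∧
    ∀ k : Fin ℓ, (k : ℕ) < m → ∑ i ∈ I, v i * G.B i k = 0

theorem annihilatesNonneg_iff {G : GaleSystem n ℓ} {P : Set (Fin ℓ → ℝ)} {m : ℕ} :
    G.AnnihilatesNonneg P m ↔ G.NonnegRelation m (G.rows P) := by
  classical
  have hsum : ∀ (v : Fin (n + ℓ + 1) → ℝ) (k : {k : Fin ℓ // (k : ℕ) < m}),
      ((fun i : {i : Fin (n + ℓ + 1) // ∀ p ∈ P, G.form i p = 0} => v i) ᵥ* G.subB P m) k =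
        ∑ i ∈ G.rows P, v i * G.B i k := by
    intro v k
    symm
    exact Finset.sum_subtype (G.rows P) (fun i => mem_rows) (fun i => v i * G.B i k)
  constructor
  · rintro ⟨v, hv0, hv, hvB⟩
    set w : Fin (n + ℓ + 1) → ℝ := fun i => if h : ∀ p ∈ P, G.form i p = 0 then v ⟨i, h⟩ else 0
      with hw
    have hwv : (fun i : {i : Fin (n + ℓ + 1) // ∀ p ∈ P, G.form i p = 0} => w i) = v := by
      ext i
      simp only [hw, dif_pos i.2]
    refine ⟨w, fun i hi => ?_, ?_, fun k hk => ?_⟩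
    · have := hv ⟨i, mem_rows.mp hi⟩
      simp only [hw, dif_pos (mem_rows.mp hi)]
      exact this
    · obtain ⟨i, hi⟩ := Function.ne_iff.mp hv0
      exact ⟨i, mem_rows.mpr i.2, by simp only [hw, dif_pos i.2]; exact hi⟩
    · have h := hsum w ⟨k, hk⟩
      rw [hwv, hvB] at h
      exact h.symm
  · rintro ⟨v, hv, ⟨i, hi, hi0⟩, hvB⟩
    refine ⟨fun i => v i, fun h => hi0 (congrFun h ⟨i, mem_rows.mp hi⟩),
      fun i => hv i (mem_rows.mpr i.2), ?_⟩
    ext k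
    rw [hsum]
    exact hvB k k.2

theorem NonnegRelation.mono {G : GaleSystem n ℓ} {m m' : ℕ} {I I' : Finset (Fin (n + ℓ + 1))}
    (h : G.NonnegRelation m I) (hm : m' ≤ m) (hI : I ⊆ I') : G.NonnegRelation m' I' := by
  classical
  obtain ⟨v, hv, ⟨i, hi, hi0⟩, hvB⟩ := h
  refine ⟨fun i => if i ∈ I then v i else 0, fun i _ => ?_, ⟨i, hI hi, by simpa [hi] using hi0⟩,
    fun k hk => ?_⟩
  · by_cases h : i ∈ I
    · simpa [h] using hv i h
    · simp [h]
  · refine Eq.trans ?_ (hvB k (by omega))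
    rw [← Finset.sum_subset hI]
    · exact Finset.sum_congr rfl fun i hi => by simp only [if_pos hi]
    · intro i _ hi
      simp only [if_neg hi, zero_mul]

/-- A set of forms active at a common point, no more numerous than the columns considered,
admits no nonnegative relation. -/
theorem not_nonnegRelation {G : GaleSystem n ℓ} (hne : G.chamber.Nonempty)
    (hbd : Bornology.IsBounded G.chamber) (h1 : G.GeneralPosition) (h2 : G.NoNonnegKernel)
    {p : Fin ℓ → ℝ} (hp : p ∈ closure G.chamber) {I : Finset (Fin (n + ℓ + 1))}
    (hI : I ⊆ G.active p) {m : ℕ} (hm : I.card ≤ m) : ¬ G.NonnegRelation m I := by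
  intro h
  have hF := isFace_faceOf hne hp hI
  refine h2 _ hF ?_
  rw [annihilatesNonneg_iff, codim_face hne hbd h1 hF, rows_faceOf hne hbd h1 hp hI]
  exact h.mono hm subset_rfl

/-- Either the rows lie in an open half-space, or at most `m + 1` of them admit a nonnegative
relation (Gordan's theorem combined with Carathéodory's). -/
theorem exists_pos_or_exists_nonnegRelation (G : GaleSystem n ℓ) (m : ℕ)
    (I : Finset (Fin (n + ℓ + 1))) :
    (∃ x : Fin ℓ → ℝ, (∀ k : Fin ℓ, m ≤ k → x k = 0) ∧ ∀ i ∈ I, 0 < ∑ k, x k * G.B i k) ∨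
      ∃ S ⊆ I, S.card ≤ m + 1 ∧ G.NonnegRelation m S := by
  classical
  let b : Fin (n + ℓ + 1) → ({k : Fin ℓ // (k : ℕ) < m} → ℝ) := fun i k => G.B i k
  by_cases h0 : (0 : {k : Fin ℓ // (k : ℕ) < m} → ℝ) ∈ convexHull ℝ (b '' I)
  · right
    obtain ⟨ι, _, z, w, hz, hind, hw, hw1, hwz⟩ := eq_pos_convex_span_of_mem_convexHull h0
    have hex : ∀ a, ∃ i ∈ I, b i = z a := fun a => hz ⟨a, rfl⟩
    choose r hrI hr using hex
    have hrinj : Function.Injective r := fun a a' h => hind.injective (by rw [← hr, ← hr, h])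
    refine ⟨Finset.univ.image r, ?_, ?_, ?_⟩
    · intro i hi
      obtain ⟨a, -, rfl⟩ := Finset.mem_image.mp hi
      exact hrI a
    · rw [Finset.card_image_of_injective _ hrinj, Finset.card_univ]
      refine hind.card_le_finrank_succ.trans (Nat.succ_le_succ ?_)
      refine (Submodule.finrank_le _).trans ?_
      rw [Module.finrank_fintype_fun_eq_card]
      refine (Fintype.card_le_of_injective
        (fun k : {k : Fin ℓ // (k : ℕ) < m} => (⟨k.1, k.2⟩ : Fin m)) ?_).trans (by simp)
      intro k k' hk
      have := congrArg Fin.val hk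
      exact Subtype.ext (Fin.ext this)
    · have hne : Nonempty ι := by
        by_contra h
        rw [not_nonempty_iff] at h
        simp at hw1
      have hinv : ∀ a, Function.invFun r (r a) = a := Function.leftInverse_invFun hrinj
      refine ⟨fun i => w (Function.invFun r i), fun i _ => (hw _).le, ?_, fun k hk => ?_⟩
      · exact ⟨r hne.some, by simp, (hw _).ne'⟩
      · rw [Finset.sum_image (fun a _ a' _ h => hrinj h)]
        have := congrFun hwz ⟨k, hk⟩
        simp only [Finset.sum_apply, Pi.smul_apply, smul_eq_mul, Pi.zero_apply] at this
        rw [← this]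
        refine Finset.sum_congr rfl fun a _ => ?_
        simp only [hinv, ← hr a, b]
  · left
    have hcl : IsClosed (convexHull ℝ (b '' I)) :=
      (I.finite_toSet.image b).isClosed_convexHull ℝ
    obtain ⟨l, u, hl0, hl⟩ := geometric_hahn_banach_point_closed (convex_convexHull ℝ _) hcl h0
    refine ⟨fun k => if h : (k : ℕ) < m then l (Pi.single ⟨k, h⟩ 1) else 0, fun k hk => ?_,
      fun i hi => ?_⟩
    · simp [not_lt.mpr hk]
    · have h1 := hl _ (subset_convexHull ℝ _ ⟨i, hi, rfl⟩)
      rw [map_zero] at hl0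
      have h2 : ∑ k : Fin ℓ, (if h : (k : ℕ) < m then l (Pi.single ⟨k, h⟩ 1) else 0) * G.B i k =
          l (b i) := by
        have h3 : b i = ∑ k : {k : Fin ℓ // (k : ℕ) < m},
            G.B i k • (Pi.single k 1 : {k : Fin ℓ // (k : ℕ) < m} → ℝ) := by
          ext k
          simp [b, Finset.sum_apply, Pi.single_apply]
        rw [h3, map_sum, ← Finset.sum_filter_add_sum_filter_not Finset.univ
          (fun k : Fin ℓ => (k : ℕ) < m), Finset.sum_eq_zero (s := Finset.univ.filter
          (fun k : Fin ℓ => ¬ (k : ℕ) < m)), add_zero]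
        · rw [Finset.sum_subtype (p := fun k : Fin ℓ => (k : ℕ) < m) _ (by simp)]
          refine Finset.sum_congr rfl fun k _ => ?_
          rw [dif_pos k.2, map_smul, smul_eq_mul, mul_comm]
        · intro k hk
          rw [dif_neg (Finset.mem_filter.mp hk).2, zero_mul]
      rw [h2]
      linarith

end GaleSystem

/-! ### The trace of the curves `φ_1 = ⋯ = φ_{j-1} = 0` on the boundary -/

theorem Real.abs_exp_sub_exp_le_mul {a b M : ℝ} (ha : Real.exp a ≤ M) (hb : Real.exp b ≤ M) :
    |Real.exp a - Real.exp b| ≤ M * |a - b| := by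
  wlog hab : b ≤ a generalizing a b
  · rw [abs_sub_comm, abs_sub_comm a b]
    exact this hb ha (le_of_not_ge hab)
  rw [abs_of_nonneg (sub_nonneg.mpr (Real.exp_le_exp.mpr hab)), abs_of_nonneg (by linarith)]
  have h1 : Real.exp b = Real.exp a * Real.exp (b - a) := by rw [← Real.exp_add]; ring_nf
  have h2 := Real.add_one_le_exp (b - a)
  calc Real.exp a - Real.exp b = Real.exp a * (1 - Real.exp (b - a)) := by rw [h1]; ring
    _ ≤ Real.exp a * (a - b) := mul_le_mul_of_nonneg_left (by linarith) (Real.exp_pos a).le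
    _ ≤ M * (a - b) := mul_le_mul_of_nonneg_right ha (by linarith)

namespace GaleSystem

variable {n ℓ : ℕ}

/-- A combination of logarithms of the forms, with positive weights on the forms vanishing at a
boundary point, tends to `-∞` at this point. -/
theorem tendsto_sum_log_atBot {G : GaleSystem n ℓ} {p : Fin ℓ → ℝ} (hp : (G.active p).Nonempty)
    {c : Fin (n + ℓ + 1) → ℝ} (hc : ∀ i ∈ G.active p, 0 < c i) :
    Filter.Tendsto (fun y => ∑ i, c i * Real.log (G.form i y)) (nhdsWithin p G.chamber)
      Filter.atBot := by
  classical
  obtain ⟨i₀, hi₀⟩ := hp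
  have hform : ∀ i, Filter.Tendsto (G.form i) (nhdsWithin p G.chamber) (nhds (G.form i p)) :=
    fun i => ((G.continuous_form i).tendsto p).mono_left nhdsWithin_le_nhds
  have hact : ∀ i ∈ G.active p, Filter.Tendsto (fun y => c i * Real.log (G.form i y))
      (nhdsWithin p G.chamber) Filter.atBot := by
    intro i hi
    refine Filter.Tendsto.const_mul_atBot (hc i hi) ?_
    refine Real.tendsto_log_nhdsGT_zero.comp ?_
    refine tendsto_nhdsWithin_iff.mpr ⟨?_, ?_⟩
    · have := hform i
      rwa [mem_active.mp hi] at this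
    · filter_upwards [self_mem_nhdsWithin] with y hy using hy i
  have hbdd : ∀ i, ∃ C : ℝ, ∀ᶠ y in nhdsWithin p G.chamber, c i * Real.log (G.form i y) ≤ C := by
    intro i
    by_cases hi : i ∈ G.active p
    · exact ⟨0, (hact i hi).eventually_le_atBot 0⟩
    · have hne : G.form i p ≠ 0 := fun h => hi (mem_active.mpr h)
      have := ((hform i).log hne).const_mul (c i)
      exact ⟨_, (this.eventually (gt_mem_nhds (lt_add_one _))).mono fun y hy => hy.le⟩
  choose C hC using hbdd
  have hsplit : (fun y => ∑ i, c i * Real.log (G.form i y)) = fun y =>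
      c i₀ * Real.log (G.form i₀ y) + ∑ i ∈ Finset.univ.erase i₀, c i * Real.log (G.form i y) := by
    ext y
    exact (Finset.add_sum_erase _ (fun i => c i * Real.log (G.form i y)) (Finset.mem_univ i₀)).symm
  rw [hsplit]
  refine Filter.tendsto_atBot_add_right_of_ge' _ (∑ i ∈ Finset.univ.erase i₀, C i) (hact i₀ hi₀) ?_
  filter_upwards [Filter.eventually_all.mpr hC] with y hy
  exact Finset.sum_le_sum fun i _ => hy i

/-- A boundary point of `μ_j` lies on a special face. -/
theorem exists_specialFace_of_mem_mu {G : GaleSystem n ℓ} (hne : G.chamber.Nonempty)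
    (hbd : Bornology.IsBounded G.chamber) (h1 : G.GeneralPosition) (h2 : G.NoNonnegKernel)
    {j : ℕ} (hj : 1 ≤ j) {p : Fin ℓ → ℝ} (hp : p ∈ G.mu j)
    (hpf : p ∈ frontier G.chamber) : ∃ P ∈ G.specialFaces j, p ∈ P := by
  obtain ⟨hpK, hpne⟩ := (mem_frontier_chamber hne).mp hpf
  rcases G.exists_pos_or_exists_nonnegRelation (j - 1) (G.active p) with ⟨x, hx0, hx⟩ | h
  · exfalso
    set S := {y ∈ G.chamber | ∀ k : Fin ℓ, (k : ℕ) + 1 < j → G.phi k y = 0} with hS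
    have hnb : (nhdsWithin p S).NeBot := mem_closure_iff_nhdsWithin_neBot.mp hp
    have htend := (tendsto_sum_log_atBot hpne hx).mono_left
      (nhdsWithin_mono p (fun y (hy : y ∈ S) => hy.1))
    obtain ⟨y, hy, hyS⟩ := ((htend.eventually_le_atBot (-1)).and self_mem_nhdsWithin).exists
    have hzero : ∑ i, (∑ k, x k * G.B i k) * Real.log (G.form i y) = 0 := by
      simp_rw [Finset.sum_mul]
      rw [Finset.sum_comm]
      refine Finset.sum_eq_zero fun k _ => ?_
      simp_rw [mul_assoc]
      rw [← Finset.mul_sum]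
      by_cases hk : (k : ℕ) + 1 < j
      · have := hyS.2 k hk
        rw [phi] at this
        rw [this, mul_zero]
      · rw [hx0 k (by omega), zero_mul]
    rw [hzero] at hy
    linarith
  · obtain ⟨S, hSI, hScard, hS⟩ := h
    have hcard : j ≤ (G.active p).card := by
      by_contra! hlt
      exact not_nonnegRelation hne hbd h1 h2 hpK subset_rfl (m := j - 1) (by omega)
        (hS.mono le_rfl hSI)
    obtain ⟨I, hSI', hII, hIcard⟩ := Finset.exists_subsuperset_card_eq hSI
      (n := j) (by omega) hcard
    have hF := isFace_faceOf hne hpK hII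
    have hrows := rows_faceOf hne hbd h1 hpK hII
    refine ⟨G.faceOf I, ⟨hF, ?_, ?_⟩, hpK, fun i hi => mem_active.mp (hII hi)⟩
    · rw [codim_face hne hbd h1 hF, hrows, hIcard]
    · rw [annihilatesNonneg_iff, hrows]
      exact hS.mono le_rfl hSI'

section Existence

variable {G : GaleSystem n ℓ} {q : Fin ℓ → ℝ} {j : ℕ}

/-- Since the only nonnegative relations among too few rows are trivial, a nonnegative relation
among `j` rows in `j - 1` columns is positive. -/
theorem relation_pos (hne : G.chamber.Nonempty)
    (hbd : Bornology.IsBounded G.chamber) (h1 : G.GeneralPosition) (h2 : G.NoNonnegKernel)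
    (hq : q ∈ closure G.chamber) (hcard : (G.active q).card = j)
    {v : Fin (n + ℓ + 1) → ℝ} (hv : ∀ i ∈ G.active q, 0 ≤ v i) (hv0 : ∃ i ∈ G.active q, v i ≠ 0)
    (hvB : ∀ k : Fin ℓ, (k : ℕ) < j - 1 → ∑ i ∈ G.active q, v i * G.B i k = 0) :
    ∀ i ∈ G.active q, 0 < v i := by
  classical
  by_contra! hcon
  obtain ⟨i, hi, hi0⟩ := hcon
  have hi0 : v i = 0 := le_antisymm hi0 (hv i hi)
  refine not_nonnegRelation hne hbd h1 h2 hq (I := (G.active q).erase i) (m := j - 1)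
    (Finset.erase_subset _ _) (by rw [Finset.card_erase_of_mem hi, hcard]) ⟨v, ?_, ?_, ?_⟩
  · exact fun m hm => hv m (Finset.mem_of_mem_erase hm)
  · obtain ⟨m, hm, hm0⟩ := hv0
    exact ⟨m, Finset.mem_erase.mpr ⟨fun h => hm0 (h ▸ hi0), hm⟩, hm0⟩
  · intro k hk
    rw [Finset.sum_erase _ (by rw [hi0, zero_mul]), hvB k hk]

/-- The transpose of the block of the exponent matrix with rows `I` and the first `m` columns. -/
def transposeMap (G : GaleSystem n ℓ) (I : Finset (Fin (n + ℓ + 1))) (m : ℕ) :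
    (I → ℝ) →ₗ[ℝ] ({k : Fin ℓ // (k : ℕ) < m} → ℝ) where
  toFun s k := ∑ i, s i * G.B i k
  map_add' s t := by ext k; simp [add_mul, Finset.sum_add_distrib]
  map_smul' c s := by ext k; simp [Finset.mul_sum, mul_assoc]

/-- The relation `v` is unique up to a factor, so the transposed block has rank `j - 1`. -/
theorem transposeMap_surjective (hne : G.chamber.Nonempty)
    (hbd : Bornology.IsBounded G.chamber) (h1 : G.GeneralPosition) (h2 : G.NoNonnegKernel)
    (hq : q ∈ closure G.chamber) (hcard : (G.active q).card = j)
    {v : Fin (n + ℓ + 1) → ℝ} (hv : ∀ i ∈ G.active q, 0 ≤ v i) (hv0 : ∃ i ∈ G.active q, v i ≠ 0)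
    (hvB : ∀ k : Fin ℓ, (k : ℕ) < j - 1 → ∑ i ∈ G.active q, v i * G.B i k = 0) :
    Function.Surjective (G.transposeMap (G.active q) (j - 1)) := by
  classical
  have hvpos := relation_pos hne hbd h1 h2 hq hcard hv hv0 hvB
  have hker : LinearMap.ker (G.transposeMap (G.active q) (j - 1)) ≤
      Submodule.span ℝ {fun i : G.active q => v i} := by
    intro u hu
    have huB : ∀ k : Fin ℓ, (k : ℕ) < j - 1 → ∑ i, u i * G.B i k = 0 := fun k hk =>
      congrFun (LinearMap.mem_ker.mp hu) ⟨k, hk⟩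
    have hneI : (Finset.univ : Finset (G.active q)).Nonempty := by
      obtain ⟨i, hi, -⟩ := hv0
      exact ⟨⟨i, hi⟩, Finset.mem_univ _⟩
    -- subtract the largest multiple of `v` that leaves a nonnegative relation
    obtain ⟨i₀, -, hmin⟩ := Finset.exists_min_image Finset.univ (fun i => u i / v i) hneI
    set t := u i₀ / v i₀ with ht
    have hnn : ∀ i, 0 ≤ u i - t * v i := by
      intro i
      have := hmin i (Finset.mem_univ i)
      rw [le_div_iff₀ (hvpos i i.2)] at this
      linarith
    have hz : u i₀ - t * v i₀ = 0 := by
      rw [ht, div_mul_cancel₀ _ (hvpos i₀ i₀.2).ne', sub_self]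
    have hall : ∀ i, u i - t * v i = 0 := by
      by_contra! hcon
      obtain ⟨i, hi⟩ := hcon
      set w : Fin (n + ℓ + 1) → ℝ := fun m =>
        if h : m ∈ G.active q then u ⟨m, h⟩ - t * v m else 0 with hw
      have hwi : ∀ i : G.active q, w i = u i - t * v i := fun i => by
        simp only [hw, dif_pos i.2]
      have h0 := relation_pos hne hbd h1 h2 hq hcard (v := w)
        (fun m hm => by rw [hwi ⟨m, hm⟩]; exact hnn _) ⟨i, i.2, by rw [hwi]; exact hi⟩
        (fun k hk => by
          rw [← Finset.sum_coe_sort]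
          simp_rw [hwi, sub_mul, mul_assoc]
          rw [Finset.sum_sub_distrib, huB k hk, ← Finset.mul_sum,
            Finset.sum_coe_sort (G.active q) (fun i => v i * G.B i k), hvB k hk]
          ring) i₀ i₀.2
      rw [hwi, hz] at h0
      exact lt_irrefl _ h0
    rw [Submodule.mem_span_singleton]
    refine ⟨t, ?_⟩
    ext i
    have := hall i
    simp only [Pi.smul_apply, smul_eq_mul]
    linarith
  have hk1 : Module.finrank ℝ (LinearMap.ker (G.transposeMap (G.active q) (j - 1))) ≤ 1 :=
    (Submodule.finrank_mono hker).trans ((finrank_span_le_card _).trans (by simp))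
  have hrn := LinearMap.finrank_range_add_finrank_ker (G.transposeMap (G.active q) (j - 1))
  rw [Module.finrank_fintype_fun_eq_card, Fintype.card_coe, hcard] at hrn
  have hF : Module.finrank ℝ ({k : Fin ℓ // (k : ℕ) < j - 1} → ℝ) ≤ j - 1 := by
    rw [Module.finrank_fintype_fun_eq_card]
    refine (Fintype.card_le_of_injective
      (fun k : {k : Fin ℓ // (k : ℕ) < j - 1} => (⟨k.1, k.2⟩ : Fin (j - 1))) ?_).trans (by simp)
    intro k k' hk
    have := congrArg Fin.val hk
    exact Subtype.ext (Fin.ext this)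
  rw [← LinearMap.range_eq_top]
  refine Submodule.eq_top_of_finrank_eq (le_antisymm (Submodule.finrank_le _) ?_)
  omega

/-- The forms active at `q` can be prescribed by moving `q` linearly. -/
theorem exists_linForm_rightInverse (hne : G.chamber.Nonempty)
    (hbd : Bornology.IsBounded G.chamber) (h1 : G.GeneralPosition)
    (hq : q ∈ closure G.chamber) :
    ∃ A : (G.active q → ℝ) →L[ℝ] (Fin ℓ → ℝ), ∀ u i, G.linForm i.1 (A u) = u i := by
  classical
  choose d hd using fun i : G.active q =>
    exists_linForm_eq hne hbd h1 hq (fun m => if m = i then 1 else 0)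
  refine ⟨LinearMap.toContinuousLinearMap (Fintype.linearCombination ℝ d), fun u i => ?_⟩
  rw [LinearMap.coe_toContinuousLinearMap', Fintype.linearCombination_apply, map_sum,
    Finset.sum_eq_single i]
  · rw [map_smul, hd i i i.2, if_pos rfl, smul_eq_mul, mul_one]
  · intro m _ hm
    rw [map_smul, hd m i i.2, if_neg (fun h => hm (Subtype.ext h.symm)), smul_zero]
  · simp

/-- The equation `T s + g (exp (s - τ v)) = 0`, with `T` linear and onto, `v > 0` and `g` of class
`C¹`, has a solution `s` for which the argument of `g` is as small as desired: for large `τ` the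
second term is a small perturbation of the constant `g 0`. -/
theorem exists_exp_solution {I F : Type*} [Fintype I] [NormedAddCommGroup F] [NormedSpace ℝ F]
    [CompleteSpace F] (T : (I → ℝ) →L[ℝ] F) (hT : Function.Surjective T) {v : I → ℝ}
    (hv : ∀ i, 0 < v i) {g : (I → ℝ) → F} (hg : ContDiffAt ℝ 1 g 0) {U : Set (I → ℝ)}
    (hU : U ∈ nhds 0) :
    ∃ (s : I → ℝ) (τ : ℝ), (fun i => Real.exp (s i - τ * v i)) ∈ U ∧
      T s + g (fun i => Real.exp (s i - τ * v i)) = 0 := by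
  obtain ⟨K, W, hW, hK⟩ := hg.exists_lipschitzOnWith
  obtain ⟨ρ, hρ, hball⟩ := Metric.nhds_basis_closedBall.mem_iff.mp (Filter.inter_mem hU hW)
  obtain ⟨s₀, hs₀⟩ := hT (-g 0)
  have hrange : T.range = ⊤ := LinearMap.range_eq_top.mpr hT
  let R := T.nonlinearRightInverseOfSurjective hrange
  have hR : 0 < (R.nnnorm : ℝ) := T.nonlinearRightInverseOfSurjective_nnnorm_pos hrange
  set δ : ℝ := min ρ ((R.nnnorm : ℝ)⁻¹ / (2 * (K + 1))) with hδ
  have hδ0 : 0 < δ := lt_min hρ (by positivity)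
  have hKδ : 2 * (K * δ) ≤ (R.nnnorm : ℝ)⁻¹ := by
    have h1 : δ ≤ (R.nnnorm : ℝ)⁻¹ / (2 * (K + 1)) := min_le_right _ _
    rw [le_div_iff₀ (by positivity)] at h1
    nlinarith [K.2]
  obtain ⟨τ, hτ⟩ : ∃ τ : ℝ, ∀ i, ‖s₀‖ + 1 - τ * v i ≤ Real.log δ := by
    have : ∀ᶠ τ : ℝ in Filter.atTop, ∀ i, ‖s₀‖ + 1 - τ * v i ≤ Real.log δ := by
      rw [Filter.eventually_all]
      intro i
      filter_upwards [(Filter.tendsto_id.atTop_mul_const (hv i)).eventually_ge_atTop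
        (‖s₀‖ + 1 - Real.log δ)] with τ hτ
      simp only [id] at hτ
      linarith
    exact this.exists
  set u : (I → ℝ) → (I → ℝ) := fun s i => Real.exp (s i - τ * v i) with hu
  have huδ : ∀ s ∈ Metric.closedBall s₀ 1, ∀ i, u s i ≤ δ := by
    intro s hs i
    rw [hu, ← Real.le_log_iff_exp_le hδ0]
    have h1 : ‖s‖ ≤ ‖s₀‖ + 1 := by
      have := norm_sub_norm_le s s₀
      rw [mem_closedBall_iff_norm] at hs
      linarith
    have h2 : s i ≤ ‖s‖ := (le_abs_self _).trans (norm_le_pi_norm s i)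
    linarith [hτ i]
  have hunorm : ∀ s ∈ Metric.closedBall s₀ 1, ‖u s‖ ≤ δ := by
    intro s hs
    rw [pi_norm_le_iff_of_nonneg hδ0.le]
    intro i
    rw [Real.norm_of_nonneg (Real.exp_pos _).le]
    exact huδ s hs i
  have hmem : ∀ s ∈ Metric.closedBall s₀ 1, u s ∈ U ∩ W := fun s hs => hball (by
    rw [mem_closedBall_zero_iff]
    exact (hunorm s hs).trans (min_le_left _ _))
  have hulip : ∀ s ∈ Metric.closedBall s₀ 1, ∀ t ∈ Metric.closedBall s₀ 1,
      ‖u s - u t‖ ≤ δ * ‖s - t‖ := by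
    intro s hs t ht
    rw [pi_norm_le_iff_of_nonneg (by positivity)]
    intro i
    refine (Real.abs_exp_sub_exp_le_mul (huδ s hs i) (huδ t ht i)).trans ?_
    have : (s i - τ * v i) - (t i - τ * v i) = (s - t) i := by simp
    rw [this]
    exact mul_le_mul_of_nonneg_left (norm_le_pi_norm (s - t) i) hδ0.le
  set f : (I → ℝ) → F := fun s => T s + g (u s) with hf
  have happrox : ApproximatesLinearOn f T (Metric.closedBall s₀ 1) (K * ⟨δ, hδ0.le⟩) := by
    intro s hs t ht
    have h1 : f s - f t - T (s - t) = g (u s) - g (u t) := by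
      simp only [hf, map_sub]
      abel
    rw [h1]
    calc ‖g (u s) - g (u t)‖ ≤ K * ‖u s - u t‖ := hK.norm_sub_le (hmem s hs).2 (hmem t ht).2
      _ ≤ K * (δ * ‖s - t‖) := mul_le_mul_of_nonneg_left (hulip s hs t ht) K.2
      _ = _ := by rw [← mul_assoc]; rfl
  have hsurj := happrox.surjOn_closedBall_of_nonlinearRightInverse R zero_le_one subset_rfl
  have hs₀mem : s₀ ∈ Metric.closedBall s₀ 1 := Metric.mem_closedBall_self zero_le_one
  have h0 : (0 : F) ∈ Metric.closedBall (f s₀)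
      (((R.nnnorm : ℝ)⁻¹ - (K * ⟨δ, hδ0.le⟩ : NNReal)) * 1) := by
    rw [mem_closedBall_iff_norm, zero_sub, norm_neg, mul_one]
    have h1 : f s₀ = g (u s₀) - g 0 := by
      simp only [hf, hs₀]
      abel
    rw [h1]
    have h2 : ‖g (u s₀) - g 0‖ ≤ K * ‖u s₀ - 0‖ :=
      hK.norm_sub_le (hmem s₀ hs₀mem).2 (mem_of_mem_nhds hW)
    rw [sub_zero] at h2
    have h3 : K * ‖u s₀‖ ≤ K * δ := mul_le_mul_of_nonneg_left (hunorm s₀ hs₀mem) K.2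
    have h4 : ((K * ⟨δ, hδ0.le⟩ : NNReal) : ℝ) = K * δ := rfl
    rw [h4]
    linarith
  obtain ⟨s, hs, hfs⟩ := hsurj h0
  exact ⟨s, τ, (hmem s hs).1, hfs⟩

theorem contDiff_form (i : Fin (n + ℓ + 1)) {m : WithTop ℕ∞} : ContDiff ℝ m (G.form i) :=
  (LinearMap.toContinuousLinearMap (G.linForm i)).contDiff.add contDiff_const

/-- A point at which exactly `j` forms vanish, and whose rows admit a nonnegative relation in
`j - 1` columns, is a limit of common zeros of `φ_1, …, φ_{j-1}` in the chamber. -/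
theorem mem_mu_of_active (hne : G.chamber.Nonempty)
    (hbd : Bornology.IsBounded G.chamber) (h1 : G.GeneralPosition) (h2 : G.NoNonnegKernel)
    (hq : q ∈ closure G.chamber) (hcard : (G.active q).card = j)
    (hrel : G.NonnegRelation (j - 1) (G.active q)) : q ∈ G.mu j := by
  classical
  obtain ⟨v, hv, hv0, hvB⟩ := hrel
  have hvpos := relation_pos hne hbd h1 h2 hq hcard hv hv0 hvB
  have hsurj := transposeMap_surjective hne hbd h1 h2 hq hcard hv hv0 hvB
  set I := G.active q with hI
  obtain ⟨A, hA⟩ : ∃ A : (I → ℝ) →L[ℝ] (Fin ℓ → ℝ), ∀ u i, G.linForm i.1 (A u) = u i :=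
    exists_linForm_rightInverse hne hbd h1 hq
  let g : (I → ℝ) → ({k : Fin ℓ // (k : ℕ) < j - 1} → ℝ) := fun u k =>
    ∑ i ∈ Finset.univ \ I, G.B i k * Real.log (G.form i (q + A u))
  have hpos : ∀ i ∈ Finset.univ \ I, 0 < G.form i q := by
    intro i hi
    refine lt_of_le_of_ne ((mem_closure_chamber hne).mp hq i) fun h => ?_
    exact (Finset.mem_sdiff.mp hi).2 (mem_active.mpr h.symm)
  have hg : ContDiffAt ℝ 1 g 0 := by
    rw [contDiffAt_pi]
    intro k
    refine ContDiffAt.sum fun i hi => contDiffAt_const.mul ?_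
    refine ContDiffAt.log ?_ ?_
    · exact ((contDiff_form i).comp (contDiff_const.add A.contDiff)).contDiffAt
    · simpa using (hpos i hi).ne'
  rw [mu, mem_closure_iff_nhds]
  intro N hN
  have hcont : Continuous fun u => q + A u := by fun_prop
  have hU : {u : I → ℝ | q + A u ∈ N ∧ ∀ i ∈ Finset.univ \ I, 0 < G.form i (q + A u)} ∈
      nhds 0 := by
    have h0 : q + A 0 = q := by simp
    refine Filter.inter_mem (hcont.continuousAt.preimage_mem_nhds (by rwa [h0])) ?_
    refine (Filter.eventually_all_finset _).mpr fun i hi => ?_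
    refine (((G.continuous_form i).comp hcont).tendsto 0).eventually (lt_mem_nhds ?_)
    simpa using hpos i hi
  obtain ⟨s, τ, ⟨hsN, hspos⟩, hs⟩ := exists_exp_solution
    (LinearMap.toContinuousLinearMap (G.transposeMap I (j - 1))) hsurj
    (v := fun i : I => v i) (fun i => hvpos i i.2) hg hU
  set u : I → ℝ := fun i => Real.exp (s i - τ * v i) with hu
  have hform : ∀ i : I, G.form i (q + A u) = u i := by
    intro i
    rw [form_add, hA, mem_active.mp i.2, zero_add]
  refine ⟨q + A u, hsN, fun i => ?_, fun k hk => ?_⟩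
  · by_cases hi : i ∈ I
    · rw [hform ⟨i, hi⟩]
      exact Real.exp_pos _
    · exact hspos i (by simp [hi])
  · have hk' : (k : ℕ) < j - 1 := by omega
    have h3 := congrFun hs ⟨k, hk'⟩
    have h4 : ∑ i : I, G.B i k * Real.log (G.form i (q + A u)) =
        ∑ i : I, s i * G.B i k := by
      have h5 : ∑ i : I, v i * G.B i k = 0 := by
        rw [Finset.sum_coe_sort I (fun i => v i * G.B i k)]
        exact hvB k hk'
      calc ∑ i : I, G.B i k * Real.log (G.form i (q + A u))
          = ∑ i : I, s i * G.B i k - τ * ∑ i : I, v i * G.B i k := by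
            rw [Finset.mul_sum, ← Finset.sum_sub_distrib]
            refine Finset.sum_congr rfl fun i _ => ?_
            rw [hform, hu, Real.log_exp]
            ring
        _ = _ := by rw [h5, mul_zero, sub_zero]
    rw [phi, ← Finset.sum_sdiff (Finset.subset_univ I), ← Finset.sum_coe_sort I, h4, add_comm]
    exact h3

theorem specialFace_subset_mu (hne : G.chamber.Nonempty)
    (hbd : Bornology.IsBounded G.chamber) (h1 : G.GeneralPosition) (h2 : G.NoNonnegKernel)
    {P : Set (Fin ℓ → ℝ)} (hP : P ∈ G.specialFaces j) : P ⊆ G.mu j := by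
  intro p hp
  obtain ⟨hF, hcod, hann⟩ := hP
  rw [codim_face hne hbd h1 hF] at hcod
  rw [annihilatesNonneg_iff] at hann
  obtain ⟨q, hq, hqr⟩ := exists_mem_active_eq_rows hne hF
  have hsub : P ⊆ closure G.chamber := hF.2.subset
  have hlim : Filter.Tendsto (fun t : ℝ => (1 - t) • p + t • q) (nhdsWithin 0 (Set.Ioo 0 1))
      (nhds p) := by
    have : Continuous (fun t : ℝ => (1 - t) • p + t • q) := by fun_prop
    have h := this.tendsto 0
    simp only [zero_smul, add_zero, sub_zero, one_smul] at h
    exact h.mono_left nhdsWithin_le_nhds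
  have hnb : (nhdsWithin (0 : ℝ) (Set.Ioo 0 1)).NeBot := by
    rw [← mem_closure_iff_nhdsWithin_neBot, closure_Ioo zero_ne_one]
    simp
  have hcl : IsClosed (G.mu j) := isClosed_closure
  refine hcl.mem_of_tendsto hlim ?_
  filter_upwards [self_mem_nhdsWithin] with t ht
  have hmem : (1 - t) • p + t • q ∈ P :=
    hF.2.convex G.convex_chamber.closure hp hq (by linarith [ht.2]) ht.1.le (by ring)
  have hact : G.active ((1 - t) • p + t • q) = G.rows P := by
    refine Finset.Subset.antisymm (fun i hi => ?_) (fun i hi =>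
      mem_active.mpr (mem_rows.mp hi _ hmem))
    rw [← hqr, mem_active]
    rw [mem_active, form_segment _ _ _ _ (by ring)] at hi
    have hp0 := (mem_closure_chamber hne).mp (hsub hp) i
    have hq0 := (mem_closure_chamber hne).mp (hsub hq) i
    have h3 : 0 ≤ (1 - t) * G.form i p := mul_nonneg (by linarith [ht.2]) hp0
    have h4 : 0 ≤ t * G.form i q := mul_nonneg ht.1.le hq0
    have h5 : t * G.form i q = 0 := by linarith
    exact (mul_eq_zero.mp h5).resolve_left ht.1.ne'
  exact mem_mu_of_active hne hbd h1 h2 (hsub hmem) (by rw [hact, hcod]) (by rwa [hact])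

theorem mu_inter_frontier (hne : G.chamber.Nonempty)
    (hbd : Bornology.IsBounded G.chamber) (h1 : G.GeneralPosition) (h2 : G.NoNonnegKernel)
    (hj : 1 ≤ j) : G.mu j ∩ frontier G.chamber = ⋃ P ∈ G.specialFaces j, P := by
  ext p
  simp only [Set.mem_inter_iff, Set.mem_iUnion, exists_prop]
  constructor
  · rintro ⟨hp, hpf⟩
    exact exists_specialFace_of_mem_mu hne hbd h1 h2 hj hp hpf
  · rintro ⟨P, hP, hp⟩
    refine ⟨specialFace_subset_mu hne hbd h1 h2 hP hp, ?_⟩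
    rw [mem_frontier_chamber hne]
    refine ⟨hP.1.2.subset hp, ?_⟩
    have hcard : 0 < (G.rows P).card := by
      rw [← codim_face hne hbd h1 hP.1, hP.2.1]
      omega
    obtain ⟨i, hi⟩ := Finset.card_pos.mp hcard
    exact ⟨i, mem_active.mpr (mem_rows.mp hi p hp)⟩

end Existence

end GaleSystem

/-! ### The cleared Jacobians -/

theorem MvPolynomial.hasFDerivAt_eval {σ : Type*} [Fintype σ] (p : MvPolynomial σ ℝ) (y : σ → ℝ) :
    HasFDerivAt (fun z => MvPolynomial.eval z p)
      (∑ c, MvPolynomial.eval y (MvPolynomial.pderiv c p) •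
        (ContinuousLinearMap.proj c : (σ → ℝ) →L[ℝ] ℝ)) y := by
  classical
  induction p using MvPolynomial.induction_on with
  | C r => simpa using hasFDerivAt_const r y
  | add p q hp hq =>
    have h : (fun z => MvPolynomial.eval z (p + q)) =
        fun z => MvPolynomial.eval z p + MvPolynomial.eval z q := by ext z; simp
    rw [h]
    refine (hp.fun_add hq).congr_fderiv ?_
    simp only [map_add, add_smul, Finset.sum_add_distrib]
  | mul_X p i hp =>
    have h : (fun z => MvPolynomial.eval z (p * MvPolynomial.X i)) =
        fun z => MvPolynomial.eval z p * z i := by ext z; simp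
    rw [h]
    refine (hp.fun_mul (hasFDerivAt_apply i y)).congr_fderiv ?_
    simp only [MvPolynomial.pderiv_mul, MvPolynomial.pderiv_X, map_add, map_mul,
      MvPolynomial.eval_X, add_smul, Finset.sum_add_distrib, Finset.smul_sum, smul_smul]
    rw [add_comm]
    congr 1
    · exact Finset.sum_congr rfl fun c _ => by rw [mul_comm]
    · symm
      rw [Finset.sum_eq_single i]
      · simp
      · intro c _ hc
        simp [hc.symm]
      · simp

theorem sum_two_pow_add_one {ℓ : ℕ} (k : Fin ℓ) :
    ∑ r : Fin ℓ, (if k < r then 2 ^ (ℓ - ((r : ℕ) + 1)) else 0) + 1 = 2 ^ (ℓ - ((k : ℕ) + 1)) := by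
  obtain ⟨m, hm⟩ : ∃ m, ℓ = (k + 1) + m := ⟨ℓ - (k + 1), by omega⟩
  have h1 : ∑ r : Fin ℓ, (if k < r then 2 ^ (ℓ - ((r : ℕ) + 1)) else 0) =
      ∑ r ∈ Finset.range ℓ, (if (k : ℕ) < r then 2 ^ (ℓ - (r + 1)) else 0) :=
    Fin.sum_univ_eq_sum_range (fun r => if (k : ℕ) < r then 2 ^ (ℓ - (r + 1)) else 0) ℓ
  have h2 : ∑ r ∈ Finset.range ℓ, (if (k : ℕ) < r then 2 ^ (ℓ - (r + 1)) else 0) =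
      ∑ x ∈ Finset.range m, 2 ^ (m - 1 - x) := by
    conv_lhs => rw [show Finset.range ℓ = Finset.range ((k + 1) + m) by rw [← hm]]
    rw [Finset.sum_range_add, Finset.sum_eq_zero, zero_add]
    · refine Finset.sum_congr rfl fun x hx => ?_
      rw [if_pos (by omega)]
      congr 1
      omega
    · intro x hx
      rw [if_neg (by have := Finset.mem_range.mp hx; omega)]
  have h3 : ℓ - ((k : ℕ) + 1) = m := by omega
  rw [h1, h2, Finset.sum_range_reflect (fun x => 2 ^ x) m, h3, Nat.geomSum_eq le_rfl]
  have := Nat.one_le_two_pow (n := m)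
  simp only [Nat.add_one_sub_one, Nat.div_one]
  omega

namespace GaleSystem

variable {n ℓ : ℕ}

open MvPolynomial

/-- The affine form `Λ_i` as a polynomial. -/
noncomputable def formPoly (G : GaleSystem n ℓ) (i : Fin (n + ℓ + 1)) : MvPolynomial (Fin ℓ) ℝ :=
  ∑ c, C (G.L i c) * X c + C (G.lam i)

theorem eval_formPoly (G : GaleSystem n ℓ) (i : Fin (n + ℓ + 1)) (y : Fin ℓ → ℝ) :
    eval y (G.formPoly i) = G.form i y := by
  simp [formPoly, form, Matrix.mulVec, dotProduct]

/-- The matrix whose determinant clears the denominators `Λ_i` of the Jacobian of the functions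
`φ_r`, for `r ≤ k`, and `f r / ∏ Λ_i ^ (a r i)`, for `r > k`: that Jacobian is a product of powers
of the `Λ_i` times a Schur complement of the upper left block. -/
noncomputable def jacobiBlock (G : GaleSystem n ℓ) (a : Fin ℓ → Fin (n + ℓ + 1) → ℝ) (k : Fin ℓ)
    (f : Fin ℓ → MvPolynomial (Fin ℓ) ℝ) :
    Matrix (Fin (n + ℓ + 1) ⊕ Fin ℓ) (Fin (n + ℓ + 1) ⊕ Fin ℓ) (MvPolynomial (Fin ℓ) ℝ) :=
  Matrix.fromBlocks (Matrix.diagonal G.formPoly) (G.L.map C)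
    (Matrix.of fun r i => if k < r then C (a r i) * f r else - C (G.B i r))
    (Matrix.of fun r c => if k < r then pderiv c (f r) else 0)

/-- The numerators of the iterated Jacobians when the denominator of the `r`-th one is chosen to be
`∏ Λ_i ^ (a r i)`. Different choices of the exponents do not affect the common zeros of the
numerators with index `≥ k`. -/
noncomputable def clearedJac (G : GaleSystem n ℓ) (a : Fin ℓ → Fin (n + ℓ + 1) → ℝ) (k : Fin ℓ) :
    MvPolynomial (Fin ℓ) ℝ :=
  (G.jacobiBlock a k fun r => if _h : k < r then G.clearedJac a r else 0).det
termination_by ℓ - (k : ℕ)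

theorem clearedJac_eq (G : GaleSystem n ℓ) (a : Fin ℓ → Fin (n + ℓ + 1) → ℝ) (k : Fin ℓ) :
    G.clearedJac a k = (G.jacobiBlock a k (G.clearedJac a)).det := by
  rw [clearedJac]
  congr 1
  rw [jacobiBlock, jacobiBlock]
  congr 1
  · ext1 r i
    by_cases h : k < r <;> simp [h]
  · ext1 r c
    by_cases h : k < r <;> simp [h]

theorem hasFDerivAt_form (G : GaleSystem n ℓ) (i : Fin (n + ℓ + 1)) (y : Fin ℓ → ℝ) :
    HasFDerivAt (G.form i) (LinearMap.toContinuousLinearMap (G.linForm i)) y :=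
  (LinearMap.toContinuousLinearMap (G.linForm i)).hasFDerivAt.add_const (G.lam i)

theorem linForm_single (G : GaleSystem n ℓ) (i : Fin (n + ℓ + 1)) (c : Fin ℓ) :
    G.linForm i (Pi.single c 1) = G.L i c := by
  simp [linForm]

theorem hasFDerivAt_log_form (G : GaleSystem n ℓ) (i : Fin (n + ℓ + 1)) {y : Fin ℓ → ℝ}
    (hy : y ∈ G.chamber) :
    HasFDerivAt (fun z => Real.log (G.form i z))
      ((G.form i y)⁻¹ • LinearMap.toContinuousLinearMap (G.linForm i)) y :=
  (G.hasFDerivAt_form i y).log (hy i).ne'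

theorem fderiv_phi_single (G : GaleSystem n ℓ) (k c : Fin ℓ) {y : Fin ℓ → ℝ}
    (hy : y ∈ G.chamber) :
    fderiv ℝ (G.phi k) y (Pi.single c 1) = ∑ i, G.B i k * (G.form i y)⁻¹ * G.L i c := by
  have h : HasFDerivAt (G.phi k) (∑ i, G.B i k •
      ((G.form i y)⁻¹ • LinearMap.toContinuousLinearMap (G.linForm i))) y :=
    HasFDerivAt.fun_sum fun i _ => (G.hasFDerivAt_log_form i hy).const_mul (G.B i k)
  rw [h.fderiv]
  simp [linForm_single, mul_assoc]

theorem exp_neg_mul_sum_log (G : GaleSystem n ℓ) (e : ℕ) {y : Fin ℓ → ℝ} (hy : y ∈ G.chamber) :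
    Real.exp (-(e : ℝ) * ∑ i, Real.log (G.form i y)) = ((∏ i, G.form i y) ^ e)⁻¹ := by
  rw [neg_mul, Real.exp_neg, Real.exp_nat_mul, Real.exp_sum]
  congr 2
  exact Finset.prod_congr rfl fun i _ => Real.exp_log (hy i)

/-- The partial derivatives of a function that equals `p / (∏ Λ_i) ^ e` on the chamber. -/
theorem fderiv_single_of_eq_mul_pow (G : GaleSystem n ℓ) {f : (Fin ℓ → ℝ) → ℝ} {e : ℕ}
    {p : MvPolynomial (Fin ℓ) ℝ}
    (hf : ∀ y ∈ G.chamber, eval y p = f y * (∏ i, G.form i y) ^ e) (c : Fin ℓ)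
    {y : Fin ℓ → ℝ} (hy : y ∈ G.chamber) :
    fderiv ℝ f y (Pi.single c 1) = ((∏ i, G.form i y) ^ e)⁻¹ *
      (eval y (pderiv c p) - ∑ i, e * eval y p * (G.form i y)⁻¹ * G.L i c) := by
  have hev : f =ᶠ[nhds y] fun z => eval z p * Real.exp (-(e : ℝ) * ∑ i, Real.log (G.form i z)) := by
    filter_upwards [G.isOpen_chamber.mem_nhds hy] with z hz
    have hpos : 0 < (∏ i, G.form i z) ^ e := pow_pos (Finset.prod_pos fun i _ => hz i) e
    rw [exp_neg_mul_sum_log _ _ hz, hf z hz, mul_assoc, mul_inv_cancel₀ hpos.ne', mul_one]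
  have hsum : HasFDerivAt (fun z => ∑ i, Real.log (G.form i z))
      (∑ i, (G.form i y)⁻¹ • LinearMap.toContinuousLinearMap (G.linForm i)) y :=
    HasFDerivAt.fun_sum fun i _ => G.hasFDerivAt_log_form i hy
  have h := (p.hasFDerivAt_eval y).fun_mul (hsum.const_mul (-(e : ℝ))).exp
  rw [hev.fderiv_eq, h.fderiv, exp_neg_mul_sum_log _ _ hy]
  simp only [add_apply, smul_apply, sum_apply, smul_eq_mul, LinearMap.coe_toContinuousLinearMap',
    linForm_single, ContinuousLinearMap.proj_apply, Pi.single_apply]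
  simp only [mul_ite, mul_one, mul_zero, Finset.sum_ite_eq', Finset.mem_univ, if_true]
  rw [show ∑ i, (e : ℝ) * eval y p * (G.form i y)⁻¹ * G.L i c =
    (e : ℝ) * eval y p * ∑ i, (G.form i y)⁻¹ * G.L i c by
      rw [Finset.mul_sum]; exact Finset.sum_congr rfl fun i _ => by ring]
  ring

/-- The exponents of the denominators `(∏ Λ_i) ^ (2 ^ (ℓ - k))` of the iterated Jacobians. -/
def fullExponent (n ℓ : ℕ) (r : Fin ℓ) (_i : Fin (n + ℓ + 1)) : ℝ :=
  (2 ^ (ℓ - ((r : ℕ) + 1)) : ℕ)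

/-- The Schur complement formula for the block matrix, at a point of the chamber. -/
theorem eval_det_jacobiBlock (G : GaleSystem n ℓ) (a : Fin ℓ → Fin (n + ℓ + 1) → ℝ) (k : Fin ℓ)
    (f : Fin ℓ → MvPolynomial (Fin ℓ) ℝ) {y : Fin ℓ → ℝ} (hy : y ∈ G.chamber) :
    eval y (G.jacobiBlock a k f).det = (∏ i, G.form i y) * (Matrix.of fun r c : Fin ℓ =>
      if k < r then eval y (pderiv c (f r)) - ∑ i, a r i * eval y (f r) * (G.form i y)⁻¹ * G.L i c
      else ∑ i, G.B i r * (G.form i y)⁻¹ * G.L i c).det := by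
  rw [RingHom.map_det, jacobiBlock, RingHom.mapMatrix_apply, Matrix.fromBlocks_map]
  have hD : (Matrix.diagonal G.formPoly).map (eval y) = Matrix.diagonal fun i => G.form i y := by
    rw [Matrix.diagonal_map (map_zero _)]
    simp only [eval_formPoly]
  rw [hD]
  let _ : Invertible (Matrix.diagonal fun i => G.form i y) :=
    ⟨Matrix.diagonal fun i => (G.form i y)⁻¹, by
      rw [Matrix.diagonal_mul_diagonal, ← Matrix.diagonal_one]
      congr 1
      ext i
      exact inv_mul_cancel₀ (hy i).ne', by
      rw [Matrix.diagonal_mul_diagonal, ← Matrix.diagonal_one]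
      congr 1
      ext i
      exact mul_inv_cancel₀ (hy i).ne'⟩
  rw [Matrix.det_fromBlocks₁₁, Matrix.det_diagonal]
  congr 2
  ext r c
  have hinv : ⅟(Matrix.diagonal fun i => G.form i y) =
    Matrix.diagonal fun i => (G.form i y)⁻¹ := rfl
  rw [hinv, Matrix.sub_apply, Matrix.mul_apply]
  simp only [Matrix.mul_diagonal, Matrix.map_apply, Matrix.of_apply, eval_C]
  by_cases h : k < r
  · simp [h]
  · simp [h]

theorem eval_clearedJac_fullExponent (G : GaleSystem n ℓ) (k : Fin ℓ) :
    ∀ y ∈ G.chamber, eval y (G.clearedJac (fullExponent n ℓ) k) =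
      G.J k y * (∏ i, G.form i y) ^ (2 ^ (ℓ - ((k : ℕ) + 1))) := by
  induction k using WellFoundedGT.induction with
  | ind k ih =>
    intro y hy
    set π := ∏ i, G.form i y with hπ
    have hπ0 : 0 < π := Finset.prod_pos fun i _ => hy i
    rw [clearedJac_eq, eval_det_jacobiBlock _ _ _ _ hy, J, jacobian]
    set N : Matrix (Fin ℓ) (Fin ℓ) ℝ := Matrix.of fun r c : Fin ℓ =>
      if k < r then eval y (pderiv c (G.clearedJac (fullExponent n ℓ) r)) -
        ∑ i, fullExponent n ℓ r i * eval y (G.clearedJac (fullExponent n ℓ) r) *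
          (G.form i y)⁻¹ * G.L i c
      else ∑ i, G.B i r * (G.form i y)⁻¹ * G.L i c with hN
    have hmat : (Matrix.of fun r c : Fin ℓ =>
        fderiv ℝ (if _h : k < r then G.J r else G.phi r) y (Pi.single c 1)) =
        Matrix.of fun r c => (if k < r then (π ^ (2 ^ (ℓ - ((r : ℕ) + 1))))⁻¹ else 1) * N r c := by
      ext r c
      simp only [Matrix.of_apply, hN]
      by_cases h : k < r
      · simp only [h, dif_pos, if_true]
        exact G.fderiv_single_of_eq_mul_pow (ih r h) c hy
      · simp only [h, dif_neg, if_false, one_mul, not_false_eq_true]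
        exact G.fderiv_phi_single r c hy
    have hprod : (∏ r : Fin ℓ, (if k < r then (π ^ (2 ^ (ℓ - ((r : ℕ) + 1))))⁻¹ else 1)) *
        π ^ (2 ^ (ℓ - ((k : ℕ) + 1))) = π := by
      have h1 : ∏ r : Fin ℓ, (if k < r then (π ^ (2 ^ (ℓ - ((r : ℕ) + 1))))⁻¹ else 1) =
          (π ^ ∑ r : Fin ℓ, (if k < r then 2 ^ (ℓ - ((r : ℕ) + 1)) else 0))⁻¹ := by
        rw [← Finset.prod_pow_eq_pow_sum, ← Finset.prod_inv_distrib]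
        refine Finset.prod_congr rfl fun r _ => ?_
        split_ifs <;> simp
      rw [h1, ← sum_two_pow_add_one k, pow_succ, ← mul_assoc,
        inv_mul_cancel₀ (pow_pos hπ0 _).ne', one_mul]
    rw [hmat, Matrix.det_mul_column]
    calc π * N.det = (∏ r : Fin ℓ, (if k < r then (π ^ (2 ^ (ℓ - ((r : ℕ) + 1))))⁻¹ else 1)) *
        π ^ (2 ^ (ℓ - ((k : ℕ) + 1))) * N.det := by rw [hprod]
      _ = _ := by ring

theorem eq_of_eval_eq_on_chamber {G : GaleSystem n ℓ} (hne : G.chamber.Nonempty)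
    {p q : MvPolynomial (Fin ℓ) ℝ} (h : ∀ y ∈ G.chamber, eval y p = eval y q) : p = q := by
  obtain ⟨y, hy⟩ := hne
  obtain ⟨ε, hε, hball⟩ := Metric.nhds_basis_closedBall.mem_iff.mp (G.isOpen_chamber.mem_nhds hy)
  refine MvPolynomial.funext_set (fun c => Metric.closedBall (y c) ε) (fun c => ?_) fun x hx => ?_
  · rw [Real.closedBall_eq_Icc]
    exact Set.Icc_infinite (by linarith)
  · refine h x (hball ?_)
    rw [closedBall_pi _ hε.le]
    exact hx

theorem isClearedJacobian_Jtilde (G : GaleSystem n ℓ) (k : Fin ℓ) :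
    G.IsClearedJacobian k (G.Jtilde k) :=
  Classical.epsilon_spec ⟨_, G.eval_clearedJac_fullExponent k⟩

theorem Jtilde_eq_clearedJac {G : GaleSystem n ℓ} (hne : G.chamber.Nonempty) (k : Fin ℓ) :
    G.Jtilde k = G.clearedJac (fullExponent n ℓ) k :=
  eq_of_eval_eq_on_chamber hne fun y hy => by
    rw [G.isClearedJacobian_Jtilde k y hy, G.eval_clearedJac_fullExponent k y hy]

end GaleSystem

/-! ### Degrees of determinants and of the cleared Jacobians -/

namespace MvPolynomial

variable {σ R : Type*} [CommRing R]

/-- The total degree of `p` is at most the integer `d`; for negative `d` this means `p = 0`. -/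
def HasDegLE (p : MvPolynomial σ R) (d : ℤ) : Prop :=
  ∀ s, p.coeff s ≠ 0 → (s.degree : ℤ) ≤ d

theorem HasDegLE.zero (d : ℤ) : HasDegLE (0 : MvPolynomial σ R) d := fun s hs => by simp at hs

theorem HasDegLE.mono {p : MvPolynomial σ R} {d e : ℤ} (h : p.HasDegLE d) (hde : d ≤ e) :
    p.HasDegLE e := fun s hs => (h s hs).trans hde

theorem hasDegLE_iff_totalDegree_le {p : MvPolynomial σ R} {d : ℕ} :
    p.HasDegLE d ↔ p.totalDegree ≤ d := by
  constructor
  · intro h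
    refine Finset.sup_le fun s hs => ?_
    have := h s (mem_support_iff.mp hs)
    exact_mod_cast this
  · intro h s hs
    have := (le_totalDegree (mem_support_iff.mpr hs)).trans h
    exact_mod_cast this

theorem HasDegLE.C (r : R) : HasDegLE (MvPolynomial.C r : MvPolynomial σ R) 0 := by
  have : HasDegLE (MvPolynomial.C r : MvPolynomial σ R) ((0 : ℕ) : ℤ) :=
    hasDegLE_iff_totalDegree_le.mpr (by simp)
  exact_mod_cast this

theorem HasDegLE.X (i : σ) : HasDegLE (MvPolynomial.X i : MvPolynomial σ R) 1 := by
  have : HasDegLE (MvPolynomial.X i : MvPolynomial σ R) ((1 : ℕ) : ℤ) :=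
    hasDegLE_iff_totalDegree_le.mpr
      ((totalDegree_monomial_le (Finsupp.single i 1) (1 : R)).trans (by simp))
  exact_mod_cast this

theorem HasDegLE.add {p q : MvPolynomial σ R} {d : ℤ} (hp : p.HasDegLE d) (hq : q.HasDegLE d) :
    (p + q).HasDegLE d := by
  intro s hs
  by_cases h : p.coeff s = 0
  · exact hq s (by rwa [coeff_add, h, zero_add] at hs)
  · exact hp s h

theorem HasDegLE.neg {p : MvPolynomial σ R} {d : ℤ} (hp : p.HasDegLE d) : (-p).HasDegLE d :=
  fun s hs => hp s (by simpa using hs)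

theorem HasDegLE.sum {ι : Type*} {s : Finset ι} {p : ι → MvPolynomial σ R} {d : ℤ}
    (h : ∀ i ∈ s, (p i).HasDegLE d) : (∑ i ∈ s, p i).HasDegLE d := by
  classical
  induction s using Finset.induction_on with
  | empty => exact HasDegLE.zero d
  | insert i s hi ih =>
    rw [Finset.sum_insert hi]
    exact (h i (by simp)).add (ih fun m hm => h m (by simp [hm]))

theorem HasDegLE.mul {p q : MvPolynomial σ R} {d e : ℤ} (hp : p.HasDegLE d) (hq : q.HasDegLE e) :
    (p * q).HasDegLE (d + e) := by
  classical
  intro s hs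
  rw [coeff_mul] at hs
  obtain ⟨x, hx, hx0⟩ := Finset.exists_ne_zero_of_sum_ne_zero hs
  rw [Finset.HasAntidiagonal.mem_antidiagonal] at hx
  have h1 := hp x.1 (left_ne_zero_of_mul hx0)
  have h2 := hq x.2 (right_ne_zero_of_mul hx0)
  rw [← hx, map_add]
  push_cast
  omega

theorem HasDegLE.prod {ι : Type*} {s : Finset ι} {p : ι → MvPolynomial σ R} {d : ι → ℤ}
    (h : ∀ i ∈ s, (p i).HasDegLE (d i)) : (∏ i ∈ s, p i).HasDegLE (∑ i ∈ s, d i) := by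
  classical
  induction s using Finset.induction_on with
  | empty =>
    rw [Finset.prod_empty, Finset.sum_empty, ← C_1]
    exact HasDegLE.C 1
  | insert i s hi ih =>
    rw [Finset.prod_insert hi, Finset.sum_insert hi]
    exact (h i (by simp)).mul (ih fun m hm => h m (by simp [hm]))

theorem HasDegLE.det {ι : Type*} [Fintype ι] [DecidableEq ι] {M : Matrix ι ι (MvPolynomial σ R)}
    {a b : ι → ℤ} (h : ∀ i j, (M i j).HasDegLE (a i + b j)) :
    M.det.HasDegLE (∑ i, a i + ∑ i, b i) := by
  rw [Matrix.det_apply]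
  refine HasDegLE.sum fun τ _ => ?_
  have h1 : (∏ i, M (τ i) i).HasDegLE (∑ i, a i + ∑ i, b i) := by
    have h2 := HasDegLE.prod (s := Finset.univ) fun i _ => h (τ i) i
    rwa [Finset.sum_add_distrib, Equiv.sum_comp τ a] at h2
  rcases Int.units_eq_one_or (Equiv.Perm.sign τ) with hs | hs
  · rwa [hs, one_smul]
  · rw [hs, Units.neg_smul, one_smul]
    exact h1.neg

theorem HasDegLE.pderiv {p : MvPolynomial σ R} {d : ℤ} (hp : p.HasDegLE d) (c : σ) :
    (MvPolynomial.pderiv c p).HasDegLE (d - 1) := by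
  intro s hs
  rw [coeff_pderiv] at hs
  have := hp _ (left_ne_zero_of_mul hs)
  rw [map_add, Finsupp.degree_single] at this
  push_cast at this
  omega

theorem coeff_X_mul_pderiv (p : MvPolynomial σ R) (c : σ) (s : σ →₀ ℕ) :
    (MvPolynomial.X c * MvPolynomial.pderiv c p).coeff s = s c * p.coeff s := by
  classical
  induction p using MvPolynomial.induction_on' with
  | monomial m r =>
    rw [X_mul_pderiv_monomial, nsmul_eq_mul, ← C_eq_coe_nat, coeff_C_mul, coeff_monomial]
    split_ifs with h
    · rw [h]
    · simp
  | add p q hp hq =>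
    rw [map_add, mul_add, coeff_add, coeff_add, hp, hq]
    ring

/-- The Euler operator minus the degree kills the part of top degree. -/
theorem HasDegLE.euler [Fintype σ] {p : MvPolynomial σ R} {d : ℕ} (hp : p.HasDegLE d) :
    (∑ c, MvPolynomial.X c * MvPolynomial.pderiv c p - MvPolynomial.C (d : R) * p).HasDegLE
      (d - 1) := by
  intro s hs
  rw [coeff_sub, coeff_sum, coeff_C_mul] at hs
  simp_rw [coeff_X_mul_pderiv] at hs
  rw [← Finset.sum_mul, ← sub_mul] at hs
  have h1 := hp s (right_ne_zero_of_mul hs)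
  have h2 : s.degree ≠ d := by
    intro h
    refine left_ne_zero_of_mul hs ?_
    rw [← h, Finsupp.degree_eq_sum]
    push_cast
    ring
  omega

end MvPolynomial

namespace GaleSystem

variable {n ℓ : ℕ}

open MvPolynomial

/-- The exponents of the denominators `Λ_0 ^ (n * 2 ^ (ℓ - r))`, whose degrees match the degree
bounds of the numerators. -/
def homogeneousExponent (n ℓ : ℕ) (r : Fin ℓ) (i : Fin (n + ℓ + 1)) : ℝ :=
  if i = 0 then ((n * 2 ^ (ℓ - ((r : ℕ) + 1)) : ℕ) : ℝ) else 0

theorem hasDegLE_formPoly (G : GaleSystem n ℓ) (i : Fin (n + ℓ + 1)) :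
    (G.formPoly i).HasDegLE 1 := by
  refine HasDegLE.add (HasDegLE.sum fun c _ => ?_) ((HasDegLE.C _).mono zero_le_one)
  simpa using (HasDegLE.C (G.L i c)).mul (HasDegLE.X c)

/-- With these exponents the numerator with index `k` has degree at most `n * 2 ^ (ℓ - k)` (in
one-based indexing). Counting degrees in the block matrix gives one more; a column operation gains
this one. -/
theorem hasDegLE_clearedJac (G : GaleSystem n ℓ) (k : Fin ℓ) :
    (G.clearedJac (homogeneousExponent n ℓ) k).HasDegLE
      ((n * 2 ^ (ℓ - ((k : ℕ) + 1)) : ℕ) : ℤ) := by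
  classical
  induction k using WellFoundedGT.induction with
  | ind k ih =>
    rw [clearedJac_eq]
    set F := G.clearedJac (homogeneousExponent n ℓ) with hF
    set M := G.jacobiBlock (homogeneousExponent n ℓ) k F with hM
    -- the combination `y_1 ∂_1 + ⋯ + y_ℓ ∂_ℓ` of the last columns, minus the sum of the first
    -- ones, has entries of lower degree by homogeneity
    let v : Fin (n + ℓ + 1) ⊕ Fin ℓ → MvPolynomial (Fin ℓ) ℝ := Sum.elim (fun _ => -1) X
    set M₁ := M.updateCol (Sum.inl 0) (fun m => ∑ i, v i • M m i) with hM₁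
    have hdet : M.det = - M₁.det := by
      rw [hM₁, Matrix.det_updateCol_sum]
      simp [v]
    let e : Fin ℓ → ℕ := fun r => if k < r then n * 2 ^ (ℓ - ((r : ℕ) + 1)) else 0
    let a : Fin (n + ℓ + 1) ⊕ Fin ℓ → ℤ := Sum.elim (fun _ => 1) (fun r => e r)
    let b : Fin (n + ℓ + 1) ⊕ Fin ℓ → ℤ :=
      Sum.elim (fun i => if i = 0 then -1 else 0) (fun _ => -1)
    have hcol : ∀ m, (∑ i, v i • M m i).HasDegLE (a m - 1) := by
      rintro (i | r)
      · have h1 : ∑ x, v x • M (Sum.inl i) x = -C (G.lam i) := by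
          simp [v, hM, jacobiBlock, Fintype.sum_sum_type, Matrix.diagonal_apply, formPoly,
            mul_comm]
        rw [h1]
        simpa [a] using (HasDegLE.C (G.lam i)).neg
      · by_cases hkr : k < r
        · have h1 : ∑ x, v x • M (Sum.inr r) x =
              ∑ c, X c * pderiv c (F r) -
                C ((n * 2 ^ (ℓ - ((r : ℕ) + 1)) : ℕ) : ℝ) * F r := by
            simp only [v, hM, jacobiBlock, Fintype.sum_sum_type, Sum.elim_inl, Sum.elim_inr,
              Matrix.fromBlocks_apply₂₁, Matrix.fromBlocks_apply₂₂, Matrix.of_apply, if_pos hkr,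
              smul_eq_mul, neg_one_mul, Finset.sum_neg_distrib, ← Finset.sum_mul]
            rw [← map_sum]
            simp only [homogeneousExponent, Finset.sum_ite_eq', Finset.mem_univ, if_true]
            ring
          rw [h1]
          simpa [a, e, hkr] using (ih r hkr).euler
        · have h1 : ∑ x, v x • M (Sum.inr r) x = 0 := by
            simp only [v, hM, jacobiBlock, Fintype.sum_sum_type, Sum.elim_inl, Sum.elim_inr,
              Matrix.fromBlocks_apply₂₁, Matrix.fromBlocks_apply₂₂, Matrix.of_apply, if_neg hkr,
              smul_eq_mul, neg_one_mul, neg_neg, mul_zero, Finset.sum_const_zero, add_zero]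
            rw [← map_sum, G.colSum, map_zero]
          rw [h1]
          exact HasDegLE.zero _
    have hentry : ∀ m x, (M₁ m x).HasDegLE (a m + b x) := by
      intro m x
      by_cases hx : x = Sum.inl 0
      · rw [hM₁, hx, Matrix.updateCol_self]
        exact hcol m
      rw [hM₁, Matrix.updateCol_ne hx]
      rcases x with i' | c
      · have hi' : i' ≠ 0 := fun h => hx (by rw [h])
        have hb : b (Sum.inl i') = 0 := by simp [b, hi']
        rw [hb, add_zero]
        rcases m with i | r
        · simp only [hM, jacobiBlock, Matrix.fromBlocks_apply₁₁, Matrix.diagonal_apply, a,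
            Sum.elim_inl]
          split_ifs
          · exact G.hasDegLE_formPoly i
          · exact HasDegLE.zero _
        · simp only [hM, jacobiBlock, Matrix.fromBlocks_apply₂₁, Matrix.of_apply, a, e,
            Sum.elim_inr]
          split_ifs with h
          · simpa using (HasDegLE.C _).mul (ih r h)
          · exact (HasDegLE.C _).neg
      · rcases m with i | r
        · simpa [hM, jacobiBlock, a, b] using HasDegLE.C (σ := Fin ℓ) (G.L i c)
        · simp only [hM, jacobiBlock, Matrix.fromBlocks_apply₂₂, Matrix.of_apply, a, b, e,
            Sum.elim_inr]
          split_ifs with h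
          · exact (ih r h).pderiv c
          · exact HasDegLE.zero _
    have hsum : ∑ m, a m + ∑ x, b x = ((n * 2 ^ (ℓ - ((k : ℕ) + 1)) : ℕ) : ℤ) := by
      have h1 : ∑ r, (e r : ℤ) + n = ((n * 2 ^ (ℓ - ((k : ℕ) + 1)) : ℕ) : ℤ) := by
        rw [← sum_two_pow_add_one k, mul_add, mul_one, Finset.mul_sum]
        push_cast
        simp [e]
      rw [← h1]
      simp [a, b, Fintype.sum_sum_type]
      ring
    rw [hdet, ← hsum]
    exact (HasDegLE.det hentry).neg

/-- Changing the exponents of the denominators changes the numerators by multiples of the numerators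
with larger index. -/
theorem exists_clearedJac_eq_add (G : GaleSystem n ℓ) (a a' : Fin ℓ → Fin (n + ℓ + 1) → ℝ)
    (k : Fin ℓ) : ∃ h : Fin ℓ → MvPolynomial (Fin ℓ) ℝ, (∀ p, p ≤ k → h p = 0) ∧
      G.clearedJac a k = G.clearedJac a' k + ∑ p, h p * G.clearedJac a' p := by
  classical
  induction k using WellFoundedGT.induction with
  | ind k ih =>
    choose! h h0 hsum using ih
    set F := G.clearedJac a with hF
    set F' := G.clearedJac a' with hF'
    set I : Ideal (MvPolynomial (Fin ℓ) ℝ) :=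
      Ideal.span (Set.range fun p : {p : Fin ℓ // k < p} => F' p) with hI
    set φ := Ideal.Quotient.mk I with hφ
    have hF'0 : ∀ r, k < r → φ (F' r) = 0 := fun r hr =>
      Ideal.Quotient.eq_zero_iff_mem.mpr (Ideal.subset_span ⟨⟨r, hr⟩, rfl⟩)
    have hterm : ∀ r, k < r → ∀ p, φ (h r p * F' p) = 0 := by
      intro r hr p
      rw [map_mul]
      by_cases hp : p ≤ r
      · rw [h0 r hr p hp, map_zero, zero_mul]
      · rw [hF'0 p (hr.trans (not_le.mp hp)), mul_zero]
    have hF0 : ∀ r, k < r → φ (F r) = 0 := by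
      intro r hr
      rw [hsum r hr, map_add, hF'0 r hr, zero_add, map_sum]
      exact Finset.sum_eq_zero fun p _ => hterm r hr p
    let U : Matrix (Fin ℓ) (Fin ℓ) (MvPolynomial (Fin ℓ) ℝ ⧸ I) := Matrix.of fun r p =>
      (if r = p then 1 else 0) + (if k < r then φ (h r p) else 0)
    have hU : U.det = 1 := by
      have hdiag : ∀ r, U r r = 1 := by
        intro r
        simp only [U, Matrix.of_apply, if_true]
        split_ifs with hr
        · rw [h0 r hr r le_rfl, map_zero, add_zero]
        · rw [add_zero]
      rw [Matrix.det_of_isUpperTriangular, Finset.prod_eq_one fun r _ => hdiag r]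
      intro r p hpr
      have hpr' : p < r := hpr
      simp only [U, Matrix.of_apply, if_neg hpr'.ne']
      split_ifs with hr
      · rw [h0 r hr p hpr'.le, map_zero, add_zero]
      · rw [add_zero]
    have hUsum : ∀ r (z : Fin ℓ → MvPolynomial (Fin ℓ) ℝ ⧸ I), ∑ p, U r p * z p =
        z r + if k < r then ∑ p, φ (h r p) * z p else 0 := by
      intro r z
      simp only [U, Matrix.of_apply, add_mul, Finset.sum_add_distrib, ite_mul, one_mul, zero_mul,
        Finset.sum_ite_eq, Finset.mem_univ, if_true]
      split_ifs <;> simp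
    -- modulo the numerators with larger index, the two block matrices differ by a unitriangular
    -- change of the rows of derivatives
    have hmat : (G.jacobiBlock a k F).map φ =
        Matrix.fromBlocks 1 0 0 U * (G.jacobiBlock a' k F').map φ := by
      rw [jacobiBlock, jacobiBlock, Matrix.fromBlocks_map, Matrix.fromBlocks_map,
        Matrix.fromBlocks_multiply]
      simp only [Matrix.one_mul, Matrix.zero_mul, add_zero, zero_add]
      congr 1
      · ext r i
        rw [Matrix.mul_apply, hUsum]
        simp only [Matrix.map_apply, Matrix.of_apply]
        split_ifs with hr
        · rw [map_mul, map_mul, hF0 r hr, hF'0 r hr, mul_zero, mul_zero, zero_add,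
            Finset.sum_eq_zero]
          intro p _
          split_ifs with hp
          · rw [map_mul, hF'0 p hp, mul_zero, mul_zero]
          · rw [h0 r hr p ((not_lt.mp hp).trans hr.le), map_zero, zero_mul]
        · rw [add_zero]
      · ext r c
        rw [Matrix.mul_apply, hUsum]
        simp only [Matrix.map_apply, Matrix.of_apply]
        split_ifs with hr
        · rw [hsum r hr, map_add, map_add, map_sum, map_sum]
          congr 1
          refine Finset.sum_congr rfl fun p _ => ?_
          by_cases hp : p ≤ r
          · rw [h0 r hr p hp]
            simp
          · have hkp : k < p := hr.trans (not_le.mp hp)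
            rw [if_pos hkp, pderiv_mul, map_add, map_mul, hF'0 p hkp, mul_zero, zero_add, map_mul]
        · simp
    have hdet : φ (F k) = φ (F' k) := by
      rw [hF, hF', clearedJac_eq, clearedJac_eq, ← hF, ← hF', RingHom.map_det, RingHom.map_det,
        RingHom.mapMatrix_apply, RingHom.mapMatrix_apply, hmat, Matrix.det_mul,
        Matrix.det_fromBlocks_zero₂₁, Matrix.det_one, hU, one_mul, one_mul]
    have hmem := (Ideal.Quotient.eq).mp hdet
    rw [hI, Ideal.mem_span_range_iff_exists_fun] at hmem
    obtain ⟨c, hc⟩ := hmem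
    refine ⟨fun p => if hp : k < p then c ⟨p, hp⟩ else 0,
      fun p hp => dif_neg (not_lt.mpr hp), ?_⟩
    rw [← sub_eq_iff_eq_add', ← hc, ← Finset.sum_filter_add_sum_filter_not Finset.univ
      (fun p : Fin ℓ => k < p), Finset.sum_eq_zero (s := Finset.univ.filter
      (fun p : Fin ℓ => ¬ k < p)), add_zero]
    · rw [Finset.sum_subtype (p := fun p : Fin ℓ => k < p) _ (by simp)]
      exact Finset.sum_congr rfl fun p _ => by simp only [dif_pos p.2]
    · intro p hp
      simp only [dif_neg (Finset.mem_filter.mp hp).2, zero_mul]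

/-- The common zeros of the numerators with index at least `j` do not depend on the exponents of
the denominators. -/
theorem aeval_clearedJac_eq_zero_of (G : GaleSystem n ℓ) (a a' : Fin ℓ → Fin (n + ℓ + 1) → ℝ)
    {A : Type*} [CommRing A] [Algebra ℝ A] {z : Fin ℓ → A} {j : ℕ}
    (hz : ∀ k : Fin ℓ, j < (k : ℕ) + 1 → aeval z (G.clearedJac a' k) = 0) :
    ∀ k : Fin ℓ, j < (k : ℕ) + 1 → aeval z (G.clearedJac a k) = 0 := by
  intro k hk
  obtain ⟨h, h0, hsum⟩ := G.exists_clearedJac_eq_add a a' k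
  rw [hsum, map_add, hz k hk, zero_add, map_sum]
  refine Finset.sum_eq_zero fun p _ => ?_
  rw [map_mul]
  by_cases hp : p ≤ k
  · rw [h0 p hp, map_zero, zero_mul]
  · have : k < p := not_le.mp hp
    rw [hz p (hk.trans (by simpa using this)), mul_zero]

end GaleSystem

/-! ### Counting the boundary zeros -/

theorem Set.ncard_biUnion_le_ncard_mul {α β : Type*} {s : Set α} (hs : s.Finite) {t : α → Set β}
    {N : ℕ} (ht : ∀ a ∈ s, (t a).ncard ≤ N) : (⋃ a ∈ s, t a).ncard ≤ s.ncard * N := by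
  induction s, hs using Set.Finite.induction_on with
  | empty => simp
  | @insert a s ha hs ih =>
    rw [Set.biUnion_insert, Set.ncard_insert_of_notMem ha hs, add_mul, one_mul, add_comm]
    exact (Set.ncard_union_le _ _).trans (add_le_add (ht a (Set.mem_insert a s))
      (ih fun b hb => ht b (Set.mem_insert_of_mem a hb)))

theorem prod_mul_two_pow (n m : ℕ) :
    ∏ a : Fin m, n * 2 ^ (m - 1 - (a : ℕ)) = 2 ^ Nat.choose m 2 * n ^ m := by
  rw [Finset.prod_mul_distrib, Finset.prod_const, Finset.card_univ, Fintype.card_fin,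
    Finset.prod_pow_eq_pow_sum, mul_comm,
    Fin.sum_univ_eq_sum_range (fun a => m - 1 - a), Finset.sum_range_reflect (fun a => a),
    Finset.sum_range_id, Nat.choose_two_right]

theorem MvPolynomial.HasDegLE.aeval {σ τ K : Type*} [Fintype σ] [Field K] [Algebra ℝ K]
    {p : MvPolynomial σ ℝ} {d : ℤ} (hp : p.HasDegLE d) {θ : σ → MvPolynomial τ K}
    (hθ : ∀ c, (θ c).HasDegLE 1) : (MvPolynomial.aeval θ p).HasDegLE d := by
  classical
  rw [p.as_sum, map_sum]
  refine HasDegLE.sum fun s hs => ?_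
  rw [MvPolynomial.aeval_monomial]
  have h1 : (s.prod fun i k => θ i ^ k).HasDegLE (s.degree : ℕ) := by
    rw [Finsupp.prod_fintype _ _ (fun i => pow_zero _), Finsupp.degree_eq_sum]
    push_cast
    refine HasDegLE.prod fun c _ => ?_
    have h2 := HasDegLE.prod (s := Finset.range (s c)) fun _ _ => hθ c
    simpa using h2
  have h2 : (algebraMap ℝ (MvPolynomial τ K) (p.coeff s)).HasDegLE 0 := by
    rw [MvPolynomial.algebraMap_apply]
    exact HasDegLE.C _
  have h3 := h2.mul h1
  rw [zero_add] at h3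
  exact h3.mono (hp s (MvPolynomial.mem_support_iff.mp hs))

namespace GaleSystem

variable {n ℓ : ℕ}

open MvPolynomial

theorem ofReal_mem_direction_affineSpan {P : Set (Fin ℓ → ℝ)} {d : Fin ℓ → ℝ}
    (hd : d ∈ (affineSpan ℝ P).direction) :
    (fun c => (d c : ℂ)) ∈
      (affineSpan ℂ ((fun (y : Fin ℓ → ℝ) (c : Fin ℓ) => (y c : ℂ)) '' P)).direction := by
  rw [direction_affineSpan, vectorSpan_def] at hd
  induction hd using Submodule.span_induction with
  | mem x hx =>
    obtain ⟨y, hy, z, hz, rfl⟩ := hx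
    have h := AffineSubspace.vsub_mem_direction
      (subset_affineSpan ℂ _ (Set.mem_image_of_mem
        (fun (y : Fin ℓ → ℝ) (c : Fin ℓ) => (y c : ℂ)) hy))
      (subset_affineSpan ℂ _ (Set.mem_image_of_mem
        (fun (y : Fin ℓ → ℝ) (c : Fin ℓ) => (y c : ℂ)) hz))
    convert h using 1
    ext c
    simp
  | zero =>
    convert Submodule.zero_mem _
    simp
  | add x y _ _ hx hy =>
    convert Submodule.add_mem _ hx hy using 1
    ext c
    simp
  | smul r x _ hx =>
    convert Submodule.smul_mem _ (r : ℂ) hx using 1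
    ext c
    simp

/-- The Bézout bound for the zeros on one special face. -/
theorem finite_and_ncard_zeros_face {G : GaleSystem n ℓ} (hne : G.chamber.Nonempty)
    (hbd : Bornology.IsBounded G.chamber) (h1 : G.GeneralPosition) {j : ℕ} (hjl : j ≤ ℓ)
    {P : Set (Fin ℓ → ℝ)} (hP : P ∈ G.specialFaces j) (hfin : (G.complexZeros P j).Finite) :
    {y ∈ P | ∀ k : Fin ℓ, j < (k : ℕ) + 1 → eval y (G.Jtilde k) = 0}.Finite ∧
    {y ∈ P | ∀ k : Fin ℓ, j < (k : ℕ) + 1 → eval y (G.Jtilde k) = 0}.ncard ≤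
      2 ^ Nat.choose (ℓ - j) 2 * n ^ (ℓ - j) := by
  classical
  obtain ⟨hF, hcod, -⟩ := hP
  obtain ⟨q, hq⟩ := hF.1
  have hrank : Module.finrank ℝ (affineSpan ℝ P).direction = ℓ - j := by
    have h2 := finrank_direction_add_card_rows hne hbd h1 hF
    rw [← codim_face hne hbd h1 hF, hcod] at h2
    omega
  let b := Module.finBasisOfFinrankEq ℝ (affineSpan ℝ P).direction hrank
  let θ : Fin ℓ → MvPolynomial (Fin (ℓ - j)) ℂ := fun c =>
    C (q c : ℂ) + ∑ a, C (((b a : Fin ℓ → ℝ) c : ℝ) : ℂ) * X a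
  let Θ : (Fin (ℓ - j) → ℂ) → (Fin ℓ → ℂ) := fun w c => eval w (θ c)
  have hΘ : ∀ w c, Θ w c = q c + ∑ a, w a * ((b a : Fin ℓ → ℝ) c : ℝ) := by
    intro w c
    simp only [Θ, θ, map_add, map_sum, map_mul, eval_C, eval_X]
    congr 1
    exact Finset.sum_congr rfl fun a _ => mul_comm _ _
  let κ : Fin (ℓ - j) → Fin ℓ := fun a => ⟨j + a, by omega⟩
  let F := G.clearedJac (homogeneousExponent n ℓ)
  let f : Fin (ℓ - j) → MvPolynomial (Fin (ℓ - j)) ℂ := fun a => aeval θ (F (κ a))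
  have heval : ∀ w (p : MvPolynomial (Fin ℓ) ℝ), eval w (aeval θ p) = aeval (Θ w) p := by
    intro w p
    induction p using MvPolynomial.induction_on with
    | C r => simp [MvPolynomial.algebraMap_apply]
    | add p q hp hq => simp only [map_add, hp, hq]
    | mul_X p i hp => simp only [map_mul, hp, aeval_X, Θ]
  have hdeg : ∀ a, (f a).totalDegree ≤ n * 2 ^ (ℓ - j - 1 - (a : ℕ)) := by
    intro a
    rw [← hasDegLE_iff_totalDegree_le]
    have h2 := G.hasDegLE_clearedJac (κ a)
    have h3 : ℓ - ((κ a : ℕ) + 1) = ℓ - j - 1 - a := by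
      simp only [κ]
      omega
    rw [h3] at h2
    refine h2.aeval fun c => ?_
    refine ((HasDegLE.C _).mono zero_le_one).add (HasDegLE.sum fun a _ => ?_)
    simpa using (HasDegLE.C (((b a : Fin ℓ → ℝ) c : ℝ) : ℂ)).mul (HasDegLE.X a)
  have hindep : ∀ x : Fin (ℓ - j) → ℝ, (∀ c, ∑ a, x a * (b a : Fin ℓ → ℝ) c = 0) → x = 0 := by
    intro x hx
    have h2 : ∑ a, x a • b a = 0 := by
      ext c
      simpa using hx c
    exact funext (Fintype.linearIndependent_iff.mp b.linearIndependent x h2)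
  have hinj : Function.Injective Θ := by
    intro w w' hw
    have h2 : ∀ c, ∑ a, (w a - w' a) * ((b a : Fin ℓ → ℝ) c : ℝ) = 0 := by
      intro c
      have h3 := congrFun hw c
      rw [hΘ, hΘ] at h3
      simp_rw [sub_mul]
      rw [Finset.sum_sub_distrib, sub_eq_zero]
      exact add_left_cancel h3
    have hre := hindep (fun a => (w a - w' a).re) fun c => by
      simpa using congrArg Complex.re (h2 c)
    have him := hindep (fun a => (w a - w' a).im) fun c => by
      simpa using congrArg Complex.im (h2 c)
    ext a
    exact sub_eq_zero.mp (Complex.ext (congrFun hre a) (congrFun him a))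
  have hJ : ∀ k, G.Jtilde k = G.clearedJac (fullExponent n ℓ) k := Jtilde_eq_clearedJac hne
  have hfin' : {w | ∀ a, eval w (f a) = 0}.Finite := by
    refine (hfin.preimage hinj.injOn).subset fun w hw => ⟨?_, ?_⟩
    · have h2 : Θ w = (∑ a, w a • fun c => (((b a : Fin ℓ → ℝ) c : ℝ) : ℂ)) +ᵥ
          fun c => (q c : ℂ) := by
        ext c
        rw [hΘ]
        simp [add_comm]
      rw [h2]
      refine AffineSubspace.vadd_mem_of_mem_direction ?_
        (subset_affineSpan ℂ _ (Set.mem_image_of_mem _ hq))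
      exact Submodule.sum_mem _ fun a _ =>
        Submodule.smul_mem _ _ (ofReal_mem_direction_affineSpan (b a).2)
    · simp_rw [hJ]
      refine G.aeval_clearedJac_eq_zero_of _ (homogeneousExponent n ℓ) fun k hk => ?_
      have h2 := hw ⟨k - j, by omega⟩
      have h3 : κ ⟨k - j, by omega⟩ = k := by
        ext
        simp only [κ]
        omega
      simp only [f, heval, h3] at h2
      exact h2
  have hsub : {y ∈ P | ∀ k : Fin ℓ, j < (k : ℕ) + 1 → eval y (G.Jtilde k) = 0} ⊆
      (fun w c => (Θ w c).re) '' {w | ∀ a, eval w (f a) = 0} := by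
    rintro y ⟨hyP, hy⟩
    have hyd : y - q ∈ (affineSpan ℝ P).direction :=
      AffineSubspace.vsub_mem_direction (subset_affineSpan ℝ P hyP) (subset_affineSpan ℝ P hq)
    set x := b.repr ⟨y - q, hyd⟩ with hx
    have hxy : ∀ c, ∑ a, x a * (b a : Fin ℓ → ℝ) c = y c - q c := by
      intro c
      have h2 := congrFun (congrArg Subtype.val (b.sum_repr ⟨y - q, hyd⟩)) c
      rw [Submodule.coe_sum, Finset.sum_apply] at h2
      simp only [Submodule.coe_smul, Pi.smul_apply, smul_eq_mul] at h2
      exact h2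
    have hΘx : Θ (fun a => (x a : ℂ)) = fun c => (y c : ℂ) := by
      ext c
      rw [hΘ]
      have h2 : (∑ a, (x a : ℂ) * ((b a : Fin ℓ → ℝ) c : ℝ)) =
          ((∑ a, x a * (b a : Fin ℓ → ℝ) c : ℝ) : ℂ) := by push_cast; rfl
      rw [h2, hxy]
      push_cast
      ring
    have hreal : ∀ p : MvPolynomial (Fin ℓ) ℝ, aeval (fun c => (y c : ℂ)) p =
        ((eval y p : ℝ) : ℂ) := by
      intro p
      have := aeval_algebraMap_apply ℂ y p
      rw [Complex.coe_algebraMap] at this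
      exact this
    refine ⟨fun a => (x a : ℂ), fun a => ?_, ?_⟩
    · rw [heval, hΘx]
      refine G.aeval_clearedJac_eq_zero_of (homogeneousExponent n ℓ) (fullExponent n ℓ) (j := j)
        (fun k hk => ?_) (κ a) (by simp only [κ]; omega)
      rw [hreal, ← hJ, hy k hk, Complex.ofReal_zero]
    · ext c
      simp only [hΘx, Complex.ofReal_re]
  refine ⟨(hfin'.image _).subset hsub, ?_⟩
  calc _ ≤ ((fun w c => (Θ w c).re) '' {w | ∀ a, eval w (f a) = 0}).ncard :=
        Set.ncard_le_ncard hsub (hfin'.image _)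
    _ ≤ {w | ∀ a, eval w (f a) = 0}.ncard := Set.ncard_image_le hfin'
    _ ≤ ∏ a : Fin (ℓ - j), n * 2 ^ (ℓ - j - 1 - (a : ℕ)) :=
        ncard_zeros_le_prod_degree f _ hdeg hfin'
    _ = _ := prod_mul_two_pow n (ℓ - j)

theorem T_subset_boundaryZeros (G : GaleSystem n ℓ) (j : ℕ) : G.T j ⊆ G.boundaryZeros j := by
  rintro y ⟨hy, hyf⟩
  have hmu : G.gam j ⊆ {y ∈ G.chamber | ∀ k : Fin ℓ, (k : ℕ) + 1 < j → G.phi k y = 0} :=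
    fun z hz => ⟨hz.1, hz.2.1⟩
  refine ⟨⟨closure_mono hmu hy, hyf⟩, fun k hk => ?_⟩
  have hcl : IsClosed {z | eval z (G.Jtilde k) = 0} :=
    isClosed_eq (MvPolynomial.continuous_eval _) continuous_const
  have hsub : G.gam j ⊆ {z | eval z (G.Jtilde k) = 0} := fun z hz => by
    rw [Set.mem_ofPred_eq, G.isClearedJacobian_Jtilde k z hz.1, hz.2.2 k hk, zero_mul]
  exact closure_minimal hsub hcl hy

theorem finite_specialFaces {G : GaleSystem n ℓ} (hne : G.chamber.Nonempty) (j : ℕ) :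
    (G.specialFaces j).Finite :=
  (Set.finite_range G.faceOf).subset fun P hP => ⟨G.rows P, (face_eq_faceOf_rows hne hP.1).symm⟩

end GaleSystem

theorem corollary3p3 {n ℓ : ℕ} (G : GaleSystem n ℓ)
    (hne : G.chamber.Nonempty) (hbd : Bornology.IsBounded G.chamber)
    (h1 : G.GeneralPosition) (h2 : G.NoNonnegKernel)
    (j : ℕ) (hj2 : 2 ≤ j) (hjl : j ≤ ℓ) :
    G.mu j ∩ frontier G.chamber = ⋃ P ∈ G.specialFaces j, P ∧
    (∀ k : Fin ℓ, G.IsClearedJacobian k (G.Jtilde k)) ∧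
    G.T j ⊆ G.boundaryZeros j ∧
    G.T j ⊆ ⋃ P ∈ G.specialFaces j, P ∧
    ((∀ P ∈ G.specialFaces j, (G.complexZeros P j).Finite) →
      (G.boundaryZeros j).Finite ∧
      (G.boundaryZeros j).ncard ≤ G.M j * (2 ^ Nat.choose (ℓ - j) 2 * n ^ (ℓ - j)) ∧
      (G.T j).Finite ∧
      (G.T j).ncard ≤ G.M j * (2 ^ Nat.choose (ℓ - j) 2 * n ^ (ℓ - j))) := by
  have hmu := GaleSystem.mu_inter_frontier hne hbd h1 h2 (j := j) (by omega)
  have hT := G.T_subset_boundaryZeros j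
  refine ⟨hmu, G.isClearedJacobian_Jtilde, hT, fun y hy => hmu ▸ (hT hy).1, fun hfin => ?_⟩
  have hZ : G.boundaryZeros j = ⋃ P ∈ G.specialFaces j,
      {y ∈ P | ∀ k : Fin ℓ, j < (k : ℕ) + 1 → MvPolynomial.eval y (G.Jtilde k) = 0} := by
    rw [GaleSystem.boundaryZeros, hmu]
    ext y
    simp only [Set.mem_ofPred_eq, Set.mem_iUnion, exists_prop]
    exact ⟨fun ⟨⟨P, hP, hy⟩, h⟩ => ⟨P, hP, hy, h⟩, fun ⟨P, hP, hy, h⟩ => ⟨⟨P, hP, hy⟩, h⟩⟩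
  have hface := fun P hP => GaleSystem.finite_and_ncard_zeros_face hne hbd h1 hjl hP (hfin P hP)
  have hSF := GaleSystem.finite_specialFaces hne j
  have hZfin : (G.boundaryZeros j).Finite := by
    rw [hZ]
    exact hSF.biUnion fun P hP => (hface P hP).1
  have hZcard : (G.boundaryZeros j).ncard ≤
      G.M j * (2 ^ Nat.choose (ℓ - j) 2 * n ^ (ℓ - j)) := by
    rw [hZ]
    exact Set.ncard_biUnion_le_ncard_mul hSF fun P hP => (hface P hP).2
  exact ⟨hZfin, hZcard, hZfin.subset hT, (Set.ncard_le_ncard hT hZfin).trans hZcard⟩
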